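/- For $u\in\mathcal S(\mathbb R^d)$ let $\hat u(\eta)=\int u(t)e^{-2\pi i t\cdot\eta}\,dt$ and $$Au(x)=A_{\Phi,\sigma}u(x)=\int_{\mathbb R^d} e^{2\pi i\Phi(x,\eta)}\sigma(x,\eta)\hat u(\eta)\,d\eta .$$ Fix a window $g\in\mathcal S(\mathbb R^d)\setminus\{0\}$. For a tempered distribution $f$ put $V_gf(x,\eta)=\langle f,M_\eta T_xg\rangle$, where $M_\eta T_xg(t)=e^{2\pi i\eta\cdot t}g(t-x)$ and $\langle\cdot,\cdot\rangle$ extends the $L^2$ inner product $\int f\bar h$, and let $\|f\|_{M^p}=\|V_gf\|_{L^p(\mathbb R^{2d})}$, $1\le p\le\infty$. Let $\sigma\in C^\infty(\mathbb R^{2d})$ be complex-valued with $$|\partial_\eta^\alpha\partial_x^\beta\sigma(x,\eta)|\le C_{\alpha,\beta}\quad\text{for all multi-indices }\alpha,\beta\text{ and all }(x,\eta)\in\mathbb R^{2d},\tag{1}$$ and let $\Phi\in C^\infty(\mathbb R^{2d})$ be real-valued with, for some $\epsilon>0$ and $\delta>0$, $$|\partial_\eta^\alpha\partial_x^\beta\Phi(x,\eta)|\le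 C'_{\alpha,\beta}\quad\text{for }|\alpha|+|\beta|\ge2\text{ and }(x,\eta)\text{ in the }\epsilon\text{-neighbourhood of }\operatorname{supp}\sigma,\tag{2}$$ $$|\partial_\eta^\alpha\partial_x^\beta\Phi(x,\eta)|\le C''_{\alpha,\beta}\quad\text{for }|\alpha|=|\beta|=1\text{ and all }(x,\eta)\in\mathbb R^{2d},\tag{3}$$ $$\left|\det\left(\frac{\partial^2\Phi}{\partial x_i\,\partial\eta_l}(x,\eta)\right)\right|>\delta\quad\text{for all }(x,\eta)\in\mathbb R^{2d}.$$ Then, for every $u\in\mathcal S(\mathbb R^d)$, the integral defining $Au(x)$ converges absolutely for every $x$, $Au\in L^\infty(\mathbb R^d)\subset\mathcal S'(\mathbb R^d)$, and $$\|Au\|_{M^p}\le C\|u\|_{M^p}\qquad\text{for every }1\le p\le\infty,$$ where, apart from $d$ and the window $g$, the constant $C$ depends only on $\delta$, $\epsilon$ and upper bounds for a finite number (determined by $d$ alone) of the constants in (1), (2) and (3). -/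

import Mathlib

open MeasureTheory SchwartzMap
open scoped FourierTransform ENNReal NNReal ContDiff ComplexConjugate

/-- `ℝ^d` with its Euclidean norm. -/
abbrev Rd (d : ℕ) : Type := EuclideanSpace ℝ (Fin d)

/-! ### Partial derivatives on `ℝ^d × ℝ^d` -/

section Partials

variable {d : ℕ} {V F : Type*} [NormedAddCommGroup V] [NormedSpace ℝ V]
  [NormedAddCommGroup F] [NormedSpace ℝ F]

/-- Iterated directional derivative along a list of directions. -/
noncomputable def dirDeriv (l : List V) (f : V → F) : V → F :=
  l.foldr (fun v h z => fderiv ℝ h z v) f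

/-- The list of directions prescribed by a multi-index `α`: the vector `e j` occurs `α j` times. -/
def dirs (e : Fin d → V) (α : Fin d → ℕ) : List V :=
  (List.finRange d).flatMap fun j => List.replicate (α j) (e j)

/-- The coordinate direction of `x_j` in `ℝ^d × ℝ^d`, whose points are written `(x, η)`. -/
noncomputable def dirX (j : Fin d) : Rd d × Rd d := (EuclideanSpace.single j 1, 0)

/-- The coordinate direction of `η_j` in `ℝ^d × ℝ^d`, whose points are written `(x, η)`. -/
noncomputable def dirEta (j : Fin d) : Rd d × Rd d := (0, EuclideanSpace.single j 1)

/-- The partial derivative `∂_η^α ∂_x^β f` of a function `f (x, η)`, for multi-indices `α`, `β`. -/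
noncomputable def partialEtaX (α β : Fin d → ℕ) (f : Rd d × Rd d → F) : Rd d × Rd d → F :=
  dirDeriv (dirs dirEta α ++ dirs dirX β) f

/-- The length `|α|` of a multi-index. -/
def multiLen (α : Fin d → ℕ) : ℕ := ∑ j, α j

/-- The matrix of mixed second derivatives `∂²Φ / ∂x_i ∂η_l` at a point `z = (x, η)`. -/
noncomputable def mixedHessian (Φ : Rd d × Rd d → ℝ) (z : Rd d × Rd d) :
    Matrix (Fin d) (Fin d) ℝ :=
  Matrix.of fun i l => partialEtaX (Pi.single l 1) (Pi.single i 1) Φ z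

end Partials

/-- The open `ε`-neighbourhood of a set in `ℝ^d × ℝ^d = ℝ^{2d}`, for the Euclidean distance of
`ℝ^{2d}` (the product type itself carries the sup distance). -/
def euclNhd {d : ℕ} (ε : ℝ) (S : Set (Rd d × Rd d)) : Set (Rd d × Rd d) :=
  {z | ∃ w ∈ S, ‖z.1 - w.1‖ ^ 2 + ‖z.2 - w.2‖ ^ 2 < ε ^ 2}

/-! ### Short-time Fourier transform and modulation spaces -/

/-- The oscillating function `t ↦ e^{-2πi η·t}`. -/
noncomputable def osc {d : ℕ} (η t : Rd d) : ℂ :=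
  Complex.exp (-(2 * Real.pi * Complex.I * (inner ℝ η t : ℝ)))

lemma iteratedDeriv_osc_line (n : ℕ) :
    iteratedDeriv n (fun s : ℝ => Complex.exp (-(2 * Real.pi * Complex.I) * (s : ℂ))) =
      fun s : ℝ => (-(2 * Real.pi * Complex.I)) ^ n *
        Complex.exp (-(2 * Real.pi * Complex.I) * (s : ℂ)) := by
  induction n with
  | zero => simp
  | succ n ih =>
    rw [iteratedDeriv_succ, ih]
    funext s
    have h1 : HasDerivAt (fun s : ℝ => -(2 * Real.pi * Complex.I) * (s : ℂ))
        (-(2 * Real.pi * Complex.I) * 1) s :=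
      (Complex.ofRealCLM.hasDerivAt (x := s)).const_mul _
    have h2 := (h1.cexp).const_mul ((-(2 * Real.pi * Complex.I)) ^ n)
    rw [h2.deriv]
    ring

lemma osc_hasTemperateGrowth {d : ℕ} (η : Rd d) : (osc η).HasTemperateGrowth := by
  have h : Function.HasTemperateGrowth
      (fun s : ℝ => Complex.exp (-(2 * Real.pi * Complex.I) * (s : ℂ))) := by
    refine ⟨?_, fun n => ⟨0, ‖(2 * Real.pi * Complex.I : ℂ)‖ ^ n, fun s => ?_⟩⟩
    · exact Complex.contDiff_exp.comp
        (contDiff_const.mul Complex.ofRealCLM.contDiff)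
    · rw [norm_iteratedFDeriv_eq_norm_iteratedDeriv, iteratedDeriv_osc_line, norm_mul, norm_pow,
        norm_neg, Complex.norm_exp]
      simp
  have h2 := h.comp (Function.hasTemperateGrowth_inner_right η)
  have : osc η = (fun s : ℝ => Complex.exp (-(2 * Real.pi * Complex.I) * (s : ℂ))) ∘
      (fun t => inner ℝ η t) := by
    funext t
    simp [osc]
  rw [this]
  exact h2

/-- The complex conjugate of the time-frequency shift `M_η T_x g` of a Schwartz function `g`,
that is, the Schwartz function `t ↦ e^{-2πi η·t} conj (g (t - x))`. -/
noncomputable def conjTFShift {d : ℕ} (g : 𝓢(Rd d, ℂ)) (x η : Rd d) : 𝓢(Rd d, ℂ) :=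
  smulLeftCLM ℂ (osc η)
    ((compSubConstCLM ℝ x g).postcompCLM (Complex.conjCLE : ℂ →L[ℝ] ℂ))

lemma conjTFShift_apply {d : ℕ} (g : 𝓢(Rd d, ℂ)) (x η t : Rd d) :
    conjTFShift g x η t = osc η t * conj (g (t - x)) := by
  simp [conjTFShift, osc_hasTemperateGrowth η]

/-- The short-time Fourier transform `V_g f (x, η) = ⟨f, M_η T_x g⟩` of a tempered distribution
`f` with window `g`, where `⟨·, ·⟩` extends the (conjugate-linear in the second variable)
inner product of `L²`. -/
noncomputable def stft {d : ℕ} (g : 𝓢(Rd d, ℂ)) (f : 𝓢'(Rd d, ℂ)) (z : Rd d × Rd d) : ℂ :=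
  f (conjTFShift g z.1 z.2)

/-- The modulation space norm `‖f‖_{M^p} = ‖V_g f‖_{L^p(ℝ^{2d})}` of a tempered distribution,
with window `g`; it is `∞` if `f` does not belong to `M^p`. -/
noncomputable def modNorm {d : ℕ} (g : 𝓢(Rd d, ℂ)) (p : ℝ≥0∞) (f : 𝓢'(Rd d, ℂ)) : ℝ≥0∞ :=
  eLpNorm (stft g f) p volume

/-! ### Fourier integral operators -/

/-- The integrand `e^{2πi Φ(x, η)} σ(x, η) û(η)` of the Fourier integral operator with phase `Φ`
and symbol `σ`; here `û(η) = ∫ u(t) e^{-2πi t·η} dt`. -/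
noncomputable def fioIntegrand {d : ℕ} (Φ : Rd d × Rd d → ℝ) (σ : Rd d × Rd d → ℂ)
    (u : 𝓢(Rd d, ℂ)) (x η : Rd d) : ℂ :=
  Complex.exp (2 * Real.pi * Complex.I * (Φ (x, η) : ℝ)) * σ (x, η) * 𝓕 u η

/-- The Fourier integral operator
`A u (x) = ∫ e^{2πi Φ(x, η)} σ(x, η) û(η) dη` on Schwartz functions. -/
noncomputable def fio {d : ℕ} (Φ : Rd d × Rd d → ℝ) (σ : Rd d × Rd d → ℂ)
    (u : 𝓢(Rd d, ℂ)) (x : Rd d) : ℂ :=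
  ∫ η, fioIntegrand Φ σ u x η

/-!
The operator is studied in phase space. Write `V f` for the short-time Fourier transform with window
`g`. The short-time Fourier transform of `A u` at `(x', η')` is an absolutely convergent double
integral in `(t, η)` (`stft_fio_eq`). Two resolutions are inserted into it: a smooth partition of
unity `1 = ∫ ψ (q - c) dc`, with `ψ` supported in a ball of radius `ε / 4`, and the reconstruction of
`𝓕 u` from `V u` (`integral_mul_fourier_eq`), which rests on Fubini's theorem alone. Hence
`V (A u) (z)` is bounded by an integral over `c` and `w` of `|V u (w)|` times the coefficient of the
operator, localized near `c`, between the time-frequency shifts of the window at `w` and at `z`.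

Such a coefficient is the Fourier integral of an amplitude supported near `c`, from whose phase the
affine part at `c` has been removed; the affine part moves the frequency to
`(η' - ∇_x Φ (c), y - ∇_η Φ (c))`. If the support of the amplitude is nonempty, then its ball lies in
the `ε`-neighbourhood of `supp σ`, where the derivatives of the phase of order at least two are
bounded; so the amplitude has bounded derivatives (`exists_amplitude_bound`), and decay of Fourier
integrals (`exists_fourier_decay`) gives the bound by a product of two kernels
(`exists_localized_coefficient_bound`). One is concentrated on `x' = x`, `η' = ∇_x Φ (x, η)`, the
other one on `y = ∇_η Φ (x, η)`, `ω = η`, where `c = (x, η)` and `w = (y, ω)`.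

Both kernels satisfy Schur's test, so their composition is bounded on all `L^p` with the same
constant (`eLpNorm_outKernel_inKernel_le`). The only integrals which are not immediate are those of
a decaying function of `∇_x Φ (x, η)` over `η`, and of `∇_η Φ (x, η)` over `x`. The Jacobian
determinants of these maps are at least `δ`, and the maps are injective by Hadamard's global
injectivity theorem (`injective_of_fderiv_bounded_below`), because the mixed Hessian has bounded
entries and hence a bounded inverse; so a change of variables bounds these integrals.
-/

/-! ### Hadamard's global injectivity theorem -/

section GlobalInjectivity

open Metric Set Topology unitInterval

variable {E : Type*} [NormedAddCommGroup E] [NormedSpace ℝ E] [FiniteDimensional ℝ E]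

lemma exists_equiv_hasStrictFDerivAt {f : E → E} (hf : ContDiff ℝ 1 f) {L : ℝ}
    (hL : ∀ x v, ‖v‖ ≤ L * ‖fderiv ℝ f x v‖) (x : E) :
    ∃ f' : E ≃L[ℝ] E, HasStrictFDerivAt f (f' : E →L[ℝ] E) x := by
  have hinj : Function.Injective (fderiv ℝ f x : E →ₗ[ℝ] E) := by
    rw [injective_iff_map_eq_zero]
    intro v hv
    have h1 := hL x v
    have h2 : fderiv ℝ f x v = 0 := hv
    rw [h2, norm_zero, mul_zero] at h1
    exact norm_le_zero_iff.1 h1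
  refine ⟨(LinearEquiv.ofInjectiveEndo _ hinj).toContinuousLinearEquiv, ?_⟩
  convert (hf.contDiffAt (x := x)).hasStrictFDerivAt one_ne_zero using 1
  ext v
  rfl

/-- A `C¹` map whose derivative has an inverse bounded by `L` has `L`-Lipschitz local sections,
on balls whose radius is uniform over a compact set. -/
lemma exists_uniform_local_section {f : E → E} (hf : ContDiff ℝ 1 f) {L : ℝ}
    (hL : ∀ x v, ‖v‖ ≤ L * ‖fderiv ℝ f x v‖) (hL0 : 0 ≤ L) {K : Set E} (hK : IsCompact K) :
    ∃ ρ > 0, ∀ b ∈ K, ∃ G : E → E, ContinuousOn G (ball (f b) ρ) ∧ G (f b) = b ∧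
      ∀ y ∈ ball (f b) ρ, f (G y) = y ∧ ‖G y - b‖ ≤ L * ‖y - f b‖ := by
  refine hK.induction_on (p := fun S => ∃ ρ > 0, ∀ b ∈ S, ∃ G : E → E,
    ContinuousOn G (ball (f b) ρ) ∧ G (f b) = b ∧
      ∀ y ∈ ball (f b) ρ, f (G y) = y ∧ ‖G y - b‖ ≤ L * ‖y - f b‖) ⟨1, one_pos, by simp⟩ ?_ ?_ ?_
  · rintro s t hst ⟨ρ, hρ, h⟩
    exact ⟨ρ, hρ, fun b hb => h b (hst hb)⟩
  · rintro s t ⟨ρ, hρ, h⟩ ⟨ρ', hρ', h'⟩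
    refine ⟨min ρ ρ', lt_min hρ hρ', fun b hb => ?_⟩
    rcases hb with hb | hb
    · obtain ⟨G, h1, h2, h3⟩ := h b hb
      have := ball_subset_ball (x := f b) (min_le_left ρ ρ')
      exact ⟨G, h1.mono this, h2, fun y hy => h3 y (this hy)⟩
    · obtain ⟨G, h1, h2, h3⟩ := h' b hb
      have := ball_subset_ball (x := f b) (min_le_right ρ ρ')
      exact ⟨G, h1.mono this, h2, fun y hy => h3 y (this hy)⟩
  · intro b₀ _
    obtain ⟨f', hf'⟩ := exists_equiv_hasStrictFDerivAt hf hL b₀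
    set φ := hf'.toOpenPartialHomeomorph f with hφ
    have hφf : ∀ x, φ x = f x := fun x => rfl
    have hb₀ : b₀ ∈ φ.source := hf'.mem_toOpenPartialHomeomorph_source
    obtain ⟨ρ, hρ, hball⟩ := Metric.isOpen_iff.1 φ.open_target (f b₀) (φ.map_source hb₀)
    refine ⟨φ.source ∩ f ⁻¹' ball (f b₀) (ρ / 2), ?_, ρ / 2, half_pos hρ, ?_⟩
    · refine mem_nhdsWithin_of_mem_nhds (Filter.inter_mem (φ.open_source.mem_nhds hb₀) ?_)
      exact hf.continuous.continuousAt.preimage_mem_nhds (ball_mem_nhds _ (half_pos hρ))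
    · rintro b ⟨hbs, hbb⟩
      have hsub : ball (f b) (ρ / 2) ⊆ φ.target := by
        refine Subset.trans (fun y hy => ?_) hball
        rw [mem_ball] at hy ⊢
        have : dist (f b) (f b₀) < ρ / 2 := hbb
        linarith [dist_triangle y (f b) (f b₀)]
      have hGb : φ.symm (f b) = b := φ.left_inv hbs
      have hd : ∀ y ∈ ball (f b) (ρ / 2), ∃ G' : E →L[ℝ] E, HasFDerivAt φ.symm G' y ∧ ‖G'‖ ≤ L := by
        intro y hy
        obtain ⟨e, he⟩ := exists_equiv_hasStrictFDerivAt hf hL (φ.symm y)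
        refine ⟨_, φ.hasFDerivAt_symm (hsub hy) he.hasFDerivAt, ?_⟩
        refine ContinuousLinearMap.opNorm_le_bound _ hL0 fun v => ?_
        have h1 := hL (φ.symm y) (e.symm v)
        rw [he.hasFDerivAt.fderiv] at h1
        simpa using h1
      refine ⟨φ.symm, φ.continuousOn_symm.mono hsub, hGb, fun y hy => ⟨φ.right_inv (hsub hy), ?_⟩⟩
      choose! G' hG' hG'L using hd
      have := (convex_ball (f b) (ρ / 2)).norm_image_sub_le_of_norm_hasFDerivWithin_le
        (fun y hy => (hG' y hy).hasFDerivWithinAt) hG'L (mem_ball_self (half_pos hρ)) hy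
      rwa [hGb] at this

/-- Lifting of line segments: the section of the previous lemma is followed along the segment in
finitely many steps of equal length; the Lipschitz bound keeps the lift in a fixed ball. -/
lemma exists_segment_lift {f : E → E} (hf : ContDiff ℝ 1 f) {L : ℝ}
    (hL : ∀ x v, ‖v‖ ≤ L * ‖fderiv ℝ f x v‖) (hL0 : 0 ≤ L) (a w : E) :
    ∃ c : ℝ → E, ContinuousOn c (Icc 0 1) ∧ c 0 = a ∧ ∀ t ∈ Icc (0 : ℝ) 1, f (c t) = f a + t • w := by
  obtain ⟨ρ, hρ, hsec⟩ := exists_uniform_local_section hf hL hL0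
    (isCompact_closedBall a (L * ‖w‖))
  obtain ⟨N, hN⟩ := exists_nat_gt (‖w‖ / ρ)
  have hN0 : (0 : ℝ) < N := lt_of_le_of_lt (by positivity) hN
  have hstep : ‖w‖ / N < ρ := by
    rw [div_lt_iff₀ hρ] at hN
    rw [div_lt_iff₀ hN0]; linarith
  suffices h : ∀ n : ℕ, n ≤ N → ∃ c : ℝ → E, ContinuousOn c (Icc 0 (n / N)) ∧ c 0 = a ∧
      ∀ t ∈ Icc (0 : ℝ) (n / N), f (c t) = f a + t • w ∧ ‖c t - a‖ ≤ L * (t * ‖w‖) by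
    obtain ⟨c, h1, h2, h3⟩ := h N le_rfl
    rw [div_self hN0.ne'] at h1 h3
    exact ⟨c, h1, h2, fun t ht => (h3 t ht).1⟩
  intro n
  induction n with
  | zero =>
    intro _
    refine ⟨fun _ => a, continuousOn_const, rfl, fun t ht => ?_⟩
    have : t = 0 := by simpa using ht
    simp [this]
  | succ n ih =>
    intro hn
    obtain ⟨c, hc, hc0, hct⟩ := ih (by omega)
    set τ : ℝ := n / N with hτ
    have hτ0 : 0 ≤ τ := by positivity
    have hτ1 : ((n + 1 : ℕ) : ℝ) / N = τ + 1 / N := by rw [hτ]; push_cast; ring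
    have hle1 : τ + 1 / N ≤ 1 := by
      rw [← hτ1, div_le_one hN0]; exact_mod_cast hn
    rw [hτ1]
    have hN1 : (0 : ℝ) < 1 / N := by positivity
    obtain ⟨hb1, hb2⟩ := hct τ ⟨hτ0, le_rfl⟩
    set b := c τ with hb
    obtain ⟨G, hG, hGb, hGy⟩ := hsec b (by
      rw [mem_closedBall, dist_eq_norm]
      refine hb2.trans (mul_le_mul_of_nonneg_left ?_ hL0)
      exact mul_le_of_le_one_left (norm_nonneg _) (by linarith))
    -- both clamped arguments coincide with `τ` on the other side of `τ`, so that the sum glues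
    have hin : ∀ t ∈ Icc (0 : ℝ) (τ + 1 / N), f a + (max τ t) • w ∈ ball (f b) ρ := by
      intro t ht
      rw [mem_ball, dist_eq_norm, hb1]
      have : f a + max τ t • w - (f a + τ • w) = (max τ t - τ) • w := by rw [sub_smul]; abel
      rw [this, norm_smul, Real.norm_eq_abs, abs_of_nonneg (by simp)]
      have h1 : max τ t - τ ≤ 1 / N := by
        rcases le_total τ t with h | h
        · rw [max_eq_right h]; linarith [ht.2]
        · rw [max_eq_left h]; linarith
      calc _ ≤ 1 / N * ‖w‖ := by gcongr
        _ = ‖w‖ / N := by ring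
        _ < ρ := hstep
    refine ⟨fun t => c (min t τ) + (G (f a + (max τ t) • w) - b), ?_, ?_, ?_⟩
    · refine ContinuousOn.add (hc.comp (by fun_prop) fun t ht => ?_)
        ((hG.comp (by fun_prop) hin).sub continuousOn_const)
      exact ⟨le_min ht.1 hτ0, min_le_right _ _⟩
    · simp only [min_eq_left hτ0, max_eq_left hτ0, hc0, ← hb1, hGb, sub_self, add_zero]
    · intro t ht
      rcases le_total t τ with h | h
      · simp only [min_eq_left h, max_eq_left h, ← hb1, hGb, sub_self, add_zero]
        exact hct t ⟨ht.1, h⟩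
      · have h3 := hGy _ (hin t ht)
        simp only [max_eq_right h] at h3
        simp only [min_eq_right h, max_eq_right h, ← hb, add_sub_cancel]
        refine ⟨h3.1, ?_⟩
        have h4 : f a + t • w - f b = (t - τ) • w := by rw [hb1, sub_smul]; abel
        rw [h4, norm_smul, Real.norm_eq_abs, abs_of_nonneg (by linarith)] at h3
        calc ‖G (f a + t • w) - a‖ ≤ ‖G (f a + t • w) - b‖ + ‖b - a‖ :=
              norm_sub_le_norm_sub_add_norm_sub _ _ _
          _ ≤ L * ((t - τ) * ‖w‖) + L * (τ * ‖w‖) := add_le_add h3.2 hb2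
          _ = L * (t * ‖w‖) := by ring

/-- **Hadamard's global injectivity theorem**: a `C¹` map `f` of a finite-dimensional space into
itself, whose derivative is everywhere invertible with an inverse bounded by `L`, is injective.
Lifting the segments from `f 0` gives a continuous right inverse `s` of `f`; then `s ∘ f` and the
identity are two lifts of `f` through `f` which agree at `0`. -/
theorem injective_of_fderiv_bounded_below {f : E → E} (hf : ContDiff ℝ 1 f) {L : ℝ}
    (hL : ∀ x v, ‖v‖ ≤ L * ‖fderiv ℝ f x v‖) (hL0 : 0 ≤ L) : Function.Injective f := by
  have homeo : IsLocalHomeomorph f := by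
    refine IsLocalHomeomorph.mk f fun x => ?_
    obtain ⟨f', hf'⟩ := exists_equiv_hasStrictFDerivAt hf hL x
    exact ⟨hf'.toOpenPartialHomeomorph f, hf'.mem_toOpenPartialHomeomorph_source, fun y _ => rfl⟩
  have sep : IsSeparatedMap f := T2Space.isSeparatedMap f
  choose c hc hc0 hct using exists_segment_lift hf hL hL0 0
  let F : C(I × E, E) := ⟨fun p => f 0 + (p.1 : ℝ) • p.2, by fun_prop⟩
  let g : I × E → E := fun p => c p.2 p.1
  have hgF : f ∘ g = F := by
    funext p
    exact hct p.2 p.1 p.1.2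
  have hgc : ∀ w, Continuous fun t : I => g (t, w) := fun w =>
    (hc w).comp_continuous continuous_subtype_val fun t => t.2
  have hg : Continuous g := by
    refine homeo.continuous_lift sep F hgF ?_ hgc
    have : (fun w => g (0, w)) = fun _ => 0 := by
      funext w
      exact hc0 w
    exact (continuous_const (y := (0 : E))).congr fun w => (congrFun this w).symm
  have hg0 : g (1, 0) = 0 := by
    have h1 := sep.const_of_comp homeo.isLocallyInjective (hgc 0) (fun t t' => by
      have h2 := congrFun hgF (t, 0)
      have h3 := congrFun hgF (t', 0)
      simp only [Function.comp_apply] at h2 h3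
      rw [h2, h3]
      simp [F]) 1 0
    rw [h1]
    exact hc0 0
  have hid : (fun x => g (1, f x - f 0)) = id := by
    refine sep.eq_of_comp_eq homeo.isLocallyInjective ?_ continuous_id ?_ 0 ?_
    · exact hg.comp (continuous_const.prodMk (hf.continuous.sub continuous_const))
    · funext x
      have h2 := congrFun hgF (1, f x - f 0)
      simp only [Function.comp_apply] at h2 ⊢
      rw [h2]
      simp [F]
    · simpa using hg0
  intro x y hxy
  have h1 := congrFun hid x
  have h2 := congrFun hid y
  simp only [hxy, id] at h1 h2
  exact h1.symm.trans h2

end GlobalInjectivity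

/-! ### Partial derivatives control the norms of the full derivatives -/

section MultiIndex

variable {d : ℕ} {V F : Type*} [NormedAddCommGroup V] [NormedSpace ℝ V]
  [NormedAddCommGroup F] [NormedSpace ℝ F]

lemma dirDeriv_cons (v : V) (l : List V) (f : V → F) (z : V) :
    dirDeriv (v :: l) f z = fderiv ℝ (dirDeriv l f) z v := rfl

lemma contDiff_dirDeriv {f : V → F} (hf : ContDiff ℝ ∞ f) (l : List V) :
    ContDiff ℝ ∞ (dirDeriv l f) := by
  induction l with
  | nil => exact hf
  | cons v l ih =>
    change ContDiff ℝ ∞ fun z => fderiv ℝ (dirDeriv l f) z v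
    exact (ih.fderiv_right (m := ∞) (by simp)).clm_apply contDiff_const

lemma dirDeriv_perm {f : V → F} (hf : ContDiff ℝ ∞ f) {l l' : List V} (h : l.Perm l') :
    dirDeriv l f = dirDeriv l' f := by
  induction h with
  | nil => rfl
  | cons v _ ih =>
    funext z
    rw [dirDeriv_cons, dirDeriv_cons, ih]
  | swap v w l =>
    funext z
    have hl := contDiff_dirDeriv hf l
    have hd : DifferentiableAt ℝ (fderiv ℝ (dirDeriv l f)) z :=
      (hl.fderiv_right (m := 1) (by norm_cast)).differentiable one_ne_zero z
    have hs : IsSymmSndFDerivAt ℝ (dirDeriv l f) z :=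
      hl.contDiffAt.isSymmSndFDerivAt (by
        rw [minSmoothness_of_isRCLikeNormedField]
        exact WithTop.coe_le_coe.2 le_top)
    have key : ∀ v w : V, dirDeriv (w :: v :: l) f z
        = fderiv ℝ (fderiv ℝ (dirDeriv l f)) z w v := by
      intro v w
      rw [dirDeriv_cons]
      change fderiv ℝ (fun y => fderiv ℝ (dirDeriv l f) y v) z w = _
      rw [fderiv_clm_apply hd (differentiableAt_const _)]
      simp
    rw [key, key]
    exact hs _ _
  | trans _ _ ih1 ih2 => exact ih1.trans ih2

lemma iteratedFDeriv_eq_dirDeriv {f : V → F} (hf : ContDiff ℝ ∞ f) (n : ℕ) (m : Fin n → V)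
    (z : V) : iteratedFDeriv ℝ n f z m = dirDeriv (List.ofFn m) f z := by
  induction n generalizing z with
  | zero => simp [dirDeriv]
  | succ n ih =>
    rw [iteratedFDeriv_succ_apply_left, List.ofFn_succ, dirDeriv_cons]
    have : dirDeriv (List.ofFn fun i => m i.succ) f
        = fun y => iteratedFDeriv ℝ n f y (Fin.tail m) := by
      funext y
      rw [ih]
      rfl
    rw [this, fderiv_continuousMultilinear_apply_const_apply]
    exact (hf.differentiable_iteratedFDeriv (by exact_mod_cast WithTop.coe_lt_top _)) z

/-- The coordinate directions of `ℝ^d × ℝ^d`: `inl j` for `x_j` and `inr j` for `η_j`. -/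
noncomputable def coordDir : Fin d ⊕ Fin d → Rd d × Rd d := Sum.elim dirX dirEta

/-- The coordinates of `ℝ^d × ℝ^d` dual to `coordDir`. -/
def coord (v : Rd d × Rd d) : Fin d ⊕ Fin d → ℝ := Sum.elim v.1.ofLp v.2.ofLp

lemma sum_smul_single (x : Rd d) : ∑ j, x j • EuclideanSpace.single j (1 : ℝ) = x := by
  ext i
  simp [Finset.sum_apply, Pi.single_apply]

lemma sum_coord_smul (v : Rd d × Rd d) : ∑ i, coord v i • coordDir i = v := by
  rw [Fintype.sum_sum_type]
  ext1
  · simpa [coord, coordDir, dirX, dirEta, Prod.fst_sum] using sum_smul_single v.1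
  · simpa [coord, coordDir, dirX, dirEta, Prod.snd_sum] using sum_smul_single v.2

lemma abs_coord_le (v : Rd d × Rd d) (i : Fin d ⊕ Fin d) : |coord v i| ≤ ‖v‖ := by
  rcases i with j | j
  · exact (PiLp.norm_apply_le v.1 j).trans (norm_fst_le v)
  · exact (PiLp.norm_apply_le v.2 j).trans (norm_snd_le v)

lemma coe_dirs {W : Type*} (e : Fin d → W) (α : Fin d → ℕ) :
    (dirs e α : Multiset W) = ∑ j, α j • ({e j} : Multiset W) := by
  rw [dirs, ← Multiset.coe_bind, Multiset.bind, Multiset.join]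
  simp [Multiset.coe_replicate, ← List.sum_ofFn, List.ofFn_eq_map,
    Multiset.nsmul_singleton]

lemma dirs_add_single_perm {W : Type*} (e : Fin d → W) (α : Fin d → ℕ) (j : Fin d) :
    (dirs e (α + Pi.single j 1)).Perm (e j :: dirs e α) := by
  rw [← Multiset.coe_eq_coe, ← Multiset.cons_coe, coe_dirs, coe_dirs,
    ← Multiset.singleton_add, add_comm]
  simp [add_smul, Finset.sum_add_distrib, Pi.single_apply, ite_smul]

lemma multiLen_add_single (α : Fin d → ℕ) (j : Fin d) :
    multiLen (α + Pi.single j 1) = multiLen α + 1 := by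
  simp [multiLen, Finset.sum_add_distrib]

/-- Every list of coordinate directions is, up to order, the one of some multi-indices. -/
lemma exists_multiIndex_perm (l : List (Fin d ⊕ Fin d)) :
    ∃ α β : Fin d → ℕ, multiLen α + multiLen β = l.length ∧
      (l.map coordDir).Perm (dirs dirEta α ++ dirs dirX β) := by
  induction l with
  | nil => exact ⟨0, 0, by simp [multiLen], by simp [dirs]⟩
  | cons i l ih =>
    obtain ⟨α, β, h1, h2⟩ := ih
    rcases i with j | j
    · refine ⟨α, β + Pi.single j 1, by simp [multiLen_add_single, ← h1, add_assoc], ?_⟩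
      refine (h2.cons (dirX j)).trans (List.perm_middle.symm.trans ?_)
      exact (dirs_add_single_perm dirX β j).symm.append_left _
    · refine ⟨α + Pi.single j 1, β, by rw [multiLen_add_single, List.length_cons, ← h1]; ring, ?_⟩
      exact (h2.cons (dirEta j)).trans ((dirs_add_single_perm dirEta α j).symm.append_right _)

/-- The full `n`-th derivative is bounded by the partial derivatives of total order `n`. -/
lemma norm_iteratedFDeriv_le_of_partialEtaX {f : Rd d × Rd d → F} (hf : ContDiff ℝ ∞ f) {n : ℕ}
    {z : Rd d × Rd d} {B : ℝ} (hB : 0 ≤ B)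
    (h : ∀ α β, multiLen α + multiLen β = n → ‖partialEtaX α β f z‖ ≤ B) :
    ‖iteratedFDeriv ℝ n f z‖ ≤ (2 * d : ℝ) ^ n * B := by
  refine ContinuousMultilinearMap.opNorm_le_bound (by positivity) fun m => ?_
  have hm : m = fun i => ∑ k, coord (m i) k • coordDir k := by
    funext i
    exact (sum_coord_smul (m i)).symm
  conv_lhs => rw [hm]
  rw [ContinuousMultilinearMap.map_sum]
  have hterm : ∀ r : Fin n → Fin d ⊕ Fin d,
      ‖iteratedFDeriv ℝ n f z (fun i => coord (m i) (r i) • coordDir (r i))‖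
        ≤ (∏ i, ‖m i‖) * B := by
    intro r
    rw [ContinuousMultilinearMap.map_smul_univ, norm_smul, norm_prod]
    refine mul_le_mul (Finset.prod_le_prod (fun _ _ => norm_nonneg _)
      fun i _ => abs_coord_le _ _) ?_ (norm_nonneg _) (Finset.prod_nonneg fun _ _ => norm_nonneg _)
    obtain ⟨α, β, h1, h2⟩ := exists_multiIndex_perm (List.ofFn r)
    rw [List.length_ofFn] at h1
    rw [iteratedFDeriv_eq_dirDeriv hf]
    rw [List.map_ofFn] at h2
    have h3 := dirDeriv_perm hf h2
    have h4 := h α β h1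
    rw [partialEtaX, ← h3] at h4
    exact h4
  refine (norm_sum_le _ _).trans ((Finset.sum_le_sum fun r _ => hterm r).trans ?_)
  rw [Finset.sum_const, Finset.card_univ, Fintype.card_fun, nsmul_eq_mul]
  simp only [Fintype.card_sum, Fintype.card_fin, Nat.cast_pow, Nat.cast_add]
  exact le_of_eq (by ring)

lemma dirs_single {W : Type*} (e : Fin d → W) (j : Fin d) : dirs e (Pi.single j 1) = [e j] := by
  have h := dirs_add_single_perm e 0 j
  rw [zero_add] at h
  have h0 : dirs e 0 = [] := by simp [dirs]
  rw [h0] at h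
  exact List.perm_singleton.1 h

lemma mixedHessian_apply {Φ : Rd d × Rd d → ℝ} (hΦ : ContDiff ℝ ∞ Φ) (z : Rd d × Rd d)
    (i l : Fin d) :
    mixedHessian Φ z i l = fderiv ℝ (fderiv ℝ Φ) z (dirEta l) (dirX i) := by
  have hd : DifferentiableAt ℝ (fderiv ℝ Φ) z :=
    (hΦ.fderiv_right (m := 1) (by norm_cast)).differentiable one_ne_zero z
  change partialEtaX (Pi.single l 1) (Pi.single i 1) Φ z = _
  rw [partialEtaX, dirs_single, dirs_single]
  change fderiv ℝ (fun y => fderiv ℝ Φ y (dirX i)) z (dirEta l) = _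
  rw [fderiv_clm_apply hd (differentiableAt_const _)]
  simp

end MultiIndex

/-! ### Decay of Fourier integrals over `ℝ^d × ℝ^d` -/

section FourierDecay

variable {d : ℕ}

/-- The Euclidean pairing of `ℝ^d × ℝ^d` (the product type carries no inner product). -/
noncomputable def euclPairing (d : ℕ) : (Rd d × Rd d) →L[ℝ] (Rd d × Rd d) →L[ℝ] ℝ :=
  (innerSL ℝ).bilinearComp (.fst ℝ (Rd d) (Rd d)) (.fst ℝ (Rd d) (Rd d)) +
    (innerSL ℝ).bilinearComp (.snd ℝ (Rd d) (Rd d)) (.snd ℝ (Rd d) (Rd d))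

lemma euclPairing_apply (q ξ : Rd d × Rd d) :
    euclPairing d q ξ = inner ℝ q.1 ξ.1 + inner ℝ q.2 ξ.2 := by
  rfl

instance : (volume : Measure (Rd d × Rd d)).IsAddHaarMeasure :=
  Measure.prod.instIsAddHaarMeasure volume volume

instance : (volume : Measure (Rd d × Rd d)).IsNegInvariant := by
  have : (volume : Measure (Rd d × Rd d)).Regular := inferInstance
  exact Measure.IsAddHaarMeasure.isNegInvariant_of_regular _

lemma norm_sq_le_euclPairing_self (ξ : Rd d × Rd d) : ‖ξ‖ ^ 2 ≤ euclPairing d ξ ξ := by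
  rw [euclPairing_apply, real_inner_self_eq_norm_sq, real_inner_self_eq_norm_sq]
  rcases max_choice ‖ξ.1‖ ‖ξ.2‖ with h | h
  · rw [Prod.norm_def, h]; nlinarith [sq_nonneg ‖ξ.2‖]
  · rw [Prod.norm_def, h]; nlinarith [sq_nonneg ‖ξ.1‖]

/-- The Fourier integral of a smooth function supported in a ball of radius `r`, whose derivatives
up to order `2 n` are bounded by `B`, decays to order `n` in each of the two dual variables, with
a constant which depends only on the dimension, `n` and `r`. -/
theorem exists_fourier_decay (d n : ℕ) (r : ℝ) :
    ∃ C : ℝ, 0 ≤ C ∧ ∀ (f : Rd d × Rd d → ℂ) (c : Rd d × Rd d) (B : ℝ), ContDiff ℝ ∞ f →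
      tsupport f ⊆ Metric.closedBall c r → 0 ≤ B →
      (∀ k ≤ 2 * n, ∀ q, ‖iteratedFDeriv ℝ k f q‖ ≤ B) → ∀ ξ : Rd d × Rd d,
        ‖∫ q, Complex.exp (-(2 * Real.pi * Complex.I * (euclPairing d q ξ : ℝ))) * f q‖ *
          ((1 + ‖ξ.1‖) ^ n * (1 + ‖ξ.2‖) ^ n) ≤ C * B := by
  set m := 2 * n with hm
  set vol : ℝ := volume.real (Metric.closedBall (0 : Rd d × Rd d) r) with hvol
  refine ⟨2 ^ m * (1 + 2 ^ m) * ((m + 1) * vol), by positivity, ?_⟩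
  intro f c B hf hsupp hB hfB ξ
  have hcs : HasCompactSupport f :=
    (isCompact_closedBall c r).of_isClosed_subset (isClosed_tsupport f) hsupp
  have hcsD : ∀ k, HasCompactSupport (iteratedFDeriv ℝ k f) := fun k => hcs.iteratedFDeriv k
  have hcont : ∀ k : ℕ, Continuous (iteratedFDeriv ℝ k f) := fun k =>
    hf.continuous_iteratedFDeriv (by exact_mod_cast le_top)
  have hint : ∀ k : ℕ, Integrable (fun v => ‖iteratedFDeriv ℝ k f v‖) := fun k =>
    ((hcont k).integrable_of_hasCompactSupport (hcsD k)).norm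
  have hbound : ∀ k ≤ m, ∫ v, ‖iteratedFDeriv ℝ k f v‖ ≤ vol * B := by
    intro k hk
    have hvolc : volume.real (Metric.closedBall c r) = vol := by
      rw [hvol, Measure.real, Measure.real, Measure.addHaar_closedBall_center]
    have hz : ∀ v ∉ Metric.closedBall c r, ‖iteratedFDeriv ℝ k f v‖ = 0 := by
      intro v hv
      rw [norm_eq_zero]
      by_contra hne
      exact hv (hsupp (support_iteratedFDeriv_subset k hne))
    rw [← setIntegral_eq_integral_of_forall_compl_eq_zero hz]
    calc ∫ v in Metric.closedBall c r, ‖iteratedFDeriv ℝ k f v‖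
        ≤ ∫ v in Metric.closedBall c r, B :=
          setIntegral_mono (hint k).integrableOn
            (integrableOn_const (by exact (isCompact_closedBall c r).measure_lt_top.ne))
            (fun v => hfB k hk v)
      _ = vol * B := by rw [setIntegral_const, hvolc, smul_eq_mul]
  set J := VectorFourier.fourierIntegral Real.fourierChar volume (euclPairing d).toLinearMap₁₂ f with hJ
  have hJeq : ∫ q, Complex.exp (-(2 * Real.pi * Complex.I * (euclPairing d q ξ : ℝ))) * f q = J ξ := by
    rw [hJ, VectorFourier.fourierIntegral]
    congr 1
    funext q
    rw [Circle.smul_def, smul_eq_mul, Real.fourierChar_apply]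
    congr 2
    push_cast
    change _ = 2 * Real.pi * (-(euclPairing d q ξ : ℂ)) * Complex.I
    ring
  rw [hJeq]
  set S := (m + 1) * (vol * B) with hS
  have hsum : ∑ p ∈ Finset.range (0 + 1) ×ˢ Finset.range (m + 1),
      ∫ v, ‖v‖ ^ p.1 * ‖iteratedFDeriv ℝ p.2 f v‖ ≤ S := by
    rw [Finset.sum_product]
    simp only [zero_add, Finset.range_one, Finset.sum_singleton, pow_zero, one_mul]
    refine (Finset.sum_le_sum (g := fun _ => vol * B) fun k hk =>
      hbound k (by simpa [Nat.lt_succ_iff] using hk)).trans ?_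
    simp [hS]
  have h0 : ‖J ξ‖ ≤ S := by
    refine (VectorFourier.norm_fourierIntegral_le_integral_norm _ _ _ _ _).trans ?_
    have h := hbound 0 (Nat.zero_le _)
    simp only [norm_iteratedFDeriv_zero] at h
    refine h.trans ?_
    have : 0 ≤ vol * B := by positivity
    rw [hS]
    nlinarith [(Nat.cast_nonneg m : (0 : ℝ) ≤ m)]
  have h1 : ‖ξ‖ ^ m * ‖J ξ‖ ≤ 2 ^ m * S := by
    rcases eq_or_ne ξ 0 with h | h
    · rw [h] at h0 ⊢
      rw [norm_zero]
      rcases Nat.eq_zero_or_pos m with h' | h'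
      · rw [h']; simpa using h0
      · rw [zero_pow h'.ne', zero_mul]
        positivity
    -- the pairing is tested on `ξ` itself, which costs one factor `‖ξ‖ ^ m`
    have key := VectorFourier.pow_mul_norm_iteratedFDeriv_fourierIntegral_le (euclPairing d)
      (f := f) (μ := volume) (K := 0) (N := m) (hf.of_le (by exact_mod_cast le_top))
      (fun k l hk hl => by
        have : k = 0 := by simpa using hk
        simpa [this] using hint l) (k := 0) (n := m) le_rfl le_rfl ξ ξ
    rw [← hJ, norm_iteratedFDeriv_zero] at key
    have hpos : 0 < ‖ξ‖ ^ m := pow_pos (norm_pos_iff.2 h) _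
    have h2 : ‖ξ‖ ^ m * ‖ξ‖ ^ m ≤ |euclPairing d ξ ξ| ^ m := by
      rw [← mul_pow, ← sq]
      exact pow_le_pow_left₀ (by positivity)
        ((norm_sq_le_euclPairing_self ξ).trans (le_abs_self _)) m
    have h3 : ‖ξ‖ ^ m * (‖ξ‖ ^ m * ‖J ξ‖) ≤ ‖ξ‖ ^ m * (2 ^ m * S) := by
      calc ‖ξ‖ ^ m * (‖ξ‖ ^ m * ‖J ξ‖) = ‖ξ‖ ^ m * ‖ξ‖ ^ m * ‖J ξ‖ := by ring
        _ ≤ |euclPairing d ξ ξ| ^ m * ‖J ξ‖ := by gcongr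
        _ ≤ ‖ξ‖ ^ m * (2 * Real.pi * ‖euclPairing d‖) ^ 0 * (2 * (0 : ℕ) + 2) ^ m * S :=
          key.trans (mul_le_mul_of_nonneg_left hsum (by positivity))
        _ = ‖ξ‖ ^ m * (2 ^ m * S) := by
          rw [pow_zero, Nat.cast_zero, mul_zero, zero_add]; ring
    exact le_of_mul_le_mul_left h3 hpos
  have h4 : (1 + ‖ξ.1‖) ^ n * (1 + ‖ξ.2‖) ^ n ≤ 2 ^ m * (1 + ‖ξ‖ ^ m) := by
    calc (1 + ‖ξ.1‖) ^ n * (1 + ‖ξ.2‖) ^ n ≤ (1 + ‖ξ‖) ^ n * (1 + ‖ξ‖) ^ n := by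
          gcongr
          · exact norm_fst_le ξ
          · exact norm_snd_le ξ
      _ = (1 + ‖ξ‖) ^ m := by rw [hm, ← pow_add]; congr 1; ring
      _ ≤ 2 ^ (m - 1) * (1 ^ m + ‖ξ‖ ^ m) := add_pow_le zero_le_one (norm_nonneg _) m
      _ ≤ 2 ^ m * (1 + ‖ξ‖ ^ m) := by
          rw [one_pow]
          gcongr
          · norm_num
          · omega
  calc ‖J ξ‖ * ((1 + ‖ξ.1‖) ^ n * (1 + ‖ξ.2‖) ^ n) ≤ ‖J ξ‖ * (2 ^ m * (1 + ‖ξ‖ ^ m)) := by gcongr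
    _ = 2 ^ m * (‖J ξ‖ + ‖ξ‖ ^ m * ‖J ξ‖) := by ring
    _ ≤ 2 ^ m * (S + 2 ^ m * S) := by gcongr
    _ = 2 ^ m * (1 + 2 ^ m) * ((m + 1) * vol) * B := by rw [hS]; ring

end FourierDecay

/-! ### Schur's test -/

section Schur

variable {X Y : Type*} [MeasurableSpace X] [MeasurableSpace Y] {μ : Measure X} {ν : Measure Y}
  [SFinite μ] [SFinite ν]

/-- **Schur's test** for a nonnegative kernel with the same bound on rows and columns. -/
theorem eLpNorm_lintegral_kernel_le {k : X → Y → ℝ≥0∞} (hk : Measurable (Function.uncurry k))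
    {f : Y → ℝ≥0∞} (hf : Measurable f) {A : ℝ≥0∞} (hrow : ∀ x, ∫⁻ y, k x y ∂ν ≤ A)
    (hcol : ∀ y, ∫⁻ x, k x y ∂μ ≤ A) {p : ℝ≥0∞} (hp : 1 ≤ p) :
    eLpNorm (fun x => ∫⁻ y, k x y * f y ∂ν) p μ ≤ A * eLpNorm f p ν := by
  have hkx : ∀ x, Measurable (k x) := fun x => hk.comp measurable_prodMk_left
  have hky : ∀ y, Measurable fun x => k x y := fun y => hk.comp measurable_prodMk_right
  rcases eq_or_ne p ∞ with rfl | hptop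
  · simp only [eLpNorm_exponent_top]
    refine eLpNormEssSup_le_of_ae_enorm_bound (Filter.Eventually.of_forall fun x => ?_)
    rw [enorm_eq_self]
    calc ∫⁻ y, k x y * f y ∂ν ≤ ∫⁻ y, k x y * eLpNormEssSup f ν ∂ν := by
          refine lintegral_mono_ae ?_
          filter_upwards [enorm_ae_le_eLpNormEssSup f ν] with y hy
          rw [enorm_eq_self] at hy
          gcongr
      _ = (∫⁻ y, k x y ∂ν) * eLpNormEssSup f ν := lintegral_mul_const _ (hkx x)
      _ ≤ A * eLpNormEssSup f ν := by gcongr; exact hrow x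
  have hp0 : p ≠ 0 := (zero_lt_one.trans_le hp).ne'
  rw [eLpNorm_eq_lintegral_rpow_enorm_toReal hp0 hptop,
    eLpNorm_eq_lintegral_rpow_enorm_toReal hp0 hptop]
  simp only [enorm_eq_self]
  set s := p.toReal with hs
  have hs1 : 1 ≤ s := by
    rw [hs, ← ENNReal.toReal_one]
    exact (ENNReal.toReal_le_toReal ENNReal.one_ne_top hptop).2 hp
  have hs0 : 0 < s := one_pos.trans_le hs1
  have hpt : ∀ x, (∫⁻ y, k x y * f y ∂ν) ^ s ≤ A ^ (s - 1) * ∫⁻ y, k x y * f y ^ s ∂ν := by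
    intro x
    rcases hs1.eq_or_lt with h | h
    · simp [← h]
    set t := Real.conjExponent s with ht
    have hst : s.HolderConjugate t := .conjExponent h
    have hst' := hst.symm
    have h1 := ENNReal.lintegral_mul_le_Lp_mul_Lq ν hst'
      (f := fun y => k x y ^ (1 / t)) (g := fun y => k x y ^ (1 / s) * f y)
      ((hkx x).pow_const _).aemeasurable (((hkx x).pow_const _).mul hf).aemeasurable
    have e1 : ∀ y, ((fun y => k x y ^ (1 / t)) * fun y => k x y ^ (1 / s) * f y) y
        = k x y * f y := by
      intro y
      simp only [Pi.mul_apply, ← mul_assoc]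
      rw [← ENNReal.rpow_add_of_nonneg _ _ hst'.one_div_nonneg hst.one_div_nonneg,
        one_div, one_div, hst'.inv_add_inv_eq_one, ENNReal.rpow_one]
    have e2 : ∀ y, (k x y ^ (1 / t)) ^ t = k x y := by
      intro y
      rw [← ENNReal.rpow_mul, one_div_mul_cancel hst'.ne_zero, ENNReal.rpow_one]
    have e3 : ∀ y, (k x y ^ (1 / s) * f y) ^ s = k x y * f y ^ s := by
      intro y
      rw [ENNReal.mul_rpow_of_nonneg _ _ hs0.le, ← ENNReal.rpow_mul,
        one_div_mul_cancel hst.ne_zero, ENNReal.rpow_one]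
    simp only [e1, e2, e3] at h1
    calc (∫⁻ y, k x y * f y ∂ν) ^ s
        ≤ ((∫⁻ y, k x y ∂ν) ^ (1 / t) * (∫⁻ y, k x y * f y ^ s ∂ν) ^ (1 / s)) ^ s := by gcongr
      _ = (∫⁻ y, k x y ∂ν) ^ (s - 1) * ∫⁻ y, k x y * f y ^ s ∂ν := by
          rw [ENNReal.mul_rpow_of_nonneg _ _ hs0.le, ← ENNReal.rpow_mul, ← ENNReal.rpow_mul,
            one_div_mul_cancel hst.ne_zero, ENNReal.rpow_one]
          congr 2
          have := hst.sub_one_mul_conj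
          rw [one_div, inv_mul_eq_div, div_eq_iff hst'.ne_zero, this]
      _ ≤ A ^ (s - 1) * ∫⁻ y, k x y * f y ^ s ∂ν := by
          gcongr
          exact hrow x
  have hmeas : Measurable (Function.uncurry fun x y => k x y * f y ^ s) :=
    hk.mul ((hf.pow_const s).comp measurable_snd)
  calc (∫⁻ x, (∫⁻ y, k x y * f y ∂ν) ^ s ∂μ) ^ (1 / s)
      ≤ (∫⁻ x, A ^ (s - 1) * ∫⁻ y, k x y * f y ^ s ∂ν ∂μ) ^ (1 / s) := by
        gcongr with x
        exact hpt x
    _ = (A ^ (s - 1) * ∫⁻ y, ∫⁻ x, k x y * f y ^ s ∂μ ∂ν) ^ (1 / s) := by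
        rw [lintegral_const_mul _ (Measurable.lintegral_prod_right hmeas),
          lintegral_lintegral_swap hmeas.aemeasurable]
    _ ≤ (A ^ (s - 1) * ∫⁻ y, A * f y ^ s ∂ν) ^ (1 / s) := by
        gcongr with y
        rw [lintegral_mul_const _ (hky y)]
        gcongr
        exact hcol y
    _ = (A ^ s * ∫⁻ y, f y ^ s ∂ν) ^ (1 / s) := by
        rw [lintegral_const_mul _ (hf.pow_const s), ← mul_assoc]
        congr 2
        nth_rewrite 2 [← ENNReal.rpow_one A]
        rw [← ENNReal.rpow_add_of_nonneg _ _ (by linarith) zero_le_one, sub_add_cancel]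
    _ = A * (∫⁻ y, f y ^ s ∂ν) ^ (1 / s) := by
        rw [ENNReal.mul_rpow_of_nonneg _ _ (by positivity), ← ENNReal.rpow_mul,
          mul_one_div_cancel hs0.ne', ENNReal.rpow_one]

end Schur

/-! ### Changes of variables with bounded Jacobian matrix -/

section ChangeOfVariables

variable {d : ℕ}

/-- The entries of the inverse of a matrix are controlled by its entries and its determinant. -/
lemma norm_le_of_matrix_bound {J : Matrix (Fin d) (Fin d) ℝ} {M δ : ℝ} (hδ : 0 < δ)
    (hM1 : 1 ≤ M) (hJ : ∀ i l, |J i l| ≤ M) (hdet : δ < |J.det|) (v : Rd d) :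
    ‖v‖ ≤ d * (d * (d.factorial * M ^ d) / δ) * ‖WithLp.toLp 2 (J.mulVec v.ofLp)‖ := by
  have hadj : ∀ i j, |J.adjugate i j| ≤ d.factorial * M ^ d := by
    intro i j
    rw [Matrix.adjugate_apply]
    have h := Matrix.det_le (A := J.updateRow j (Pi.single i 1)) (abv := AbsoluteValue.abs)
      (x := M) (fun a b => by
        rw [AbsoluteValue.abs_apply, Matrix.updateRow_apply]
        split_ifs with h
        · rw [Pi.single_apply]
          split_ifs
          · simpa using hM1
          · simpa using zero_le_one.trans hM1
        · exact hJ a b)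
    simpa [nsmul_eq_mul] using h
  have hM0 : 0 ≤ M := zero_le_one.trans hM1
  set y := J.mulVec v.ofLp with hy
  have hcomp : ∀ i, |v i| ≤ d * (d.factorial * M ^ d) / δ * ‖WithLp.toLp 2 y‖ := by
    intro i
    have h1 : J.adjugate.mulVec y = J.det • v.ofLp := by
      rw [hy, Matrix.mulVec_mulVec, Matrix.adjugate_mul, Matrix.smul_mulVec, Matrix.one_mulVec]
    have h2 : J.det * v i = ∑ j, J.adjugate i j * y j := by
      have := congrFun h1 i
      simpa [Matrix.mulVec, dotProduct] using this.symm
    have h3 : |J.det| * |v i| ≤ d * (d.factorial * M ^ d) * ‖WithLp.toLp 2 y‖ := by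
      rw [← abs_mul, h2]
      refine (Finset.abs_sum_le_sum_abs _ _).trans ?_
      have : ∀ j ∈ Finset.univ, |J.adjugate i j * y j|
          ≤ (d.factorial * M ^ d) * ‖WithLp.toLp 2 y‖ := fun j _ => by
        rw [abs_mul]
        exact mul_le_mul (hadj i j) (PiLp.norm_apply_le (WithLp.toLp 2 y) j) (abs_nonneg _)
          (by positivity)
      refine (Finset.sum_le_sum this).trans (le_of_eq ?_)
      simp [mul_assoc]
    rw [div_mul_eq_mul_div, le_div_iff₀ hδ]
    have := mul_le_mul_of_nonneg_right hdet.le (abs_nonneg (v i))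
    linarith
  have hsum : ‖v‖ ≤ ∑ i, |v i| := by
    calc ‖v‖ = ‖∑ j, v j • EuclideanSpace.single j (1 : ℝ)‖ := by rw [sum_smul_single]
      _ ≤ ∑ j, ‖v j • EuclideanSpace.single j (1 : ℝ)‖ := norm_sum_le _ _
      _ = ∑ i, |v i| := by simp [norm_smul]
  refine hsum.trans ((Finset.sum_le_sum fun i _ => hcomp i).trans (le_of_eq ?_))
  simp [mul_assoc]

/-- If the Jacobian matrix of `F` has bounded entries and determinant at least `δ`, then composing
with `F` costs at most the factor `δ⁻¹` in integrals. -/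
theorem lintegral_comp_le_of_jacobian {F : Rd d → Rd d} (hF : ContDiff ℝ 1 F)
    {J : Rd d → Matrix (Fin d) (Fin d) ℝ}
    (hJ : ∀ b i l, J b i l = fderiv ℝ F b (EuclideanSpace.single l 1) i) {M δ : ℝ} (hδ : 0 < δ)
    (hM : ∀ b i l, |J b i l| ≤ M) (hdet : ∀ b, δ < |(J b).det|) (g : Rd d → ℝ≥0∞) :
    ∫⁻ b, g (F b) ≤ ENNReal.ofReal δ⁻¹ * ∫⁻ v, g v := by
  have hmat : ∀ b, LinearMap.toMatrix (EuclideanSpace.basisFun (Fin d) ℝ).toBasis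
      (EuclideanSpace.basisFun (Fin d) ℝ).toBasis (fderiv ℝ F b : Rd d →ₗ[ℝ] Rd d) = J b := by
    intro b
    ext i l
    rw [hJ, LinearMap.toMatrix_apply]
    simp
  have happ : ∀ b v, fderiv ℝ F b v = WithLp.toLp 2 ((J b).mulVec v.ofLp) := by
    intro b v
    have h := LinearMap.toMatrix_mulVec_repr (EuclideanSpace.basisFun (Fin d) ℝ).toBasis
      (EuclideanSpace.basisFun (Fin d) ℝ).toBasis (fderiv ℝ F b : Rd d →ₗ[ℝ] Rd d) v
    rw [hmat] at h
    ext i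
    have := congrFun h i
    exact this.symm
  have hinj : Function.Injective F := by
    refine injective_of_fderiv_bounded_below hF
      (L := d * (d * (d.factorial * (max M 1) ^ d) / δ)) (fun b v => ?_) (by positivity)
    rw [happ]
    exact norm_le_of_matrix_bound hδ (le_max_right _ _)
      (fun i l => (hM b i l).trans (le_max_left _ _)) (hdet b) v
  have hdetF : ∀ b, (fderiv ℝ F b).det = (J b).det := by
    intro b
    rw [← hmat b, LinearMap.det_toMatrix]
  have key := lintegral_image_eq_lintegral_abs_det_fderiv_mul volume MeasurableSet.univ
    (fun b _ => ((hF.differentiable one_ne_zero) b).hasFDerivAt.hasFDerivWithinAt)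
    hinj.injOn g
  have h1 : ENNReal.ofReal δ * ∫⁻ b, g (F b) ≤ ∫⁻ v, g v := by
    calc ENNReal.ofReal δ * ∫⁻ b, g (F b)
        = ∫⁻ b, ENNReal.ofReal δ * g (F b) := (lintegral_const_mul' _ _ ENNReal.ofReal_ne_top).symm
      _ ≤ ∫⁻ b, ENNReal.ofReal |(fderiv ℝ F b).det| * g (F b) := by
          gcongr with b
          rw [hdetF]
          exact (hdet b).le
      _ = ∫⁻ x in F '' Set.univ, g x := by rw [key, Measure.restrict_univ]
      _ ≤ ∫⁻ v, g v := setLIntegral_le_lintegral _ _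
  have hδ0 : ENNReal.ofReal δ ≠ 0 := by simpa using hδ
  rw [ENNReal.ofReal_inv_of_pos hδ]
  calc ∫⁻ b, g (F b) = (ENNReal.ofReal δ)⁻¹ * (ENNReal.ofReal δ * ∫⁻ b, g (F b)) := by
        rw [← mul_assoc, ENNReal.inv_mul_cancel hδ0 ENNReal.ofReal_ne_top, one_mul]
    _ ≤ _ := by gcongr

end ChangeOfVariables

/-! ### The gradients of the phase and the associated kernels -/

section Kernels

variable {d : ℕ}

/-- The integrable weight `(1 + |v|)^{-(d+1)}` on `ℝ^d`. -/
noncomputable def decayWeight (v : Rd d) : ℝ≥0∞ := ENNReal.ofReal (((1 + ‖v‖) ^ (d + 1))⁻¹)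

lemma decayWeight_ne_top (v : Rd d) : decayWeight v ≠ ⊤ := ENNReal.ofReal_ne_top

lemma continuous_decayWeight : Continuous (decayWeight (d := d)) := by
  refine ENNReal.continuous_ofReal.comp (Continuous.inv₀ (by fun_prop) fun v => ?_)
  positivity

lemma lintegral_decayWeight_lt_top : ∫⁻ v : Rd d, decayWeight v < ⊤ := by
  have h := finite_integral_one_add_norm (E := Rd d) (μ := volume) (r := (d + 1 : ℕ))
    (by simp)
  refine lt_of_eq_of_lt (lintegral_congr fun v => ?_) h
  rw [decayWeight, Real.rpow_neg (by positivity), Real.rpow_natCast]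

lemma lintegral_decayWeight_sub_right (a : Rd d) :
    ∫⁻ v, decayWeight (v - a) = ∫⁻ v : Rd d, decayWeight v :=
  lintegral_sub_right_eq_self _ a

lemma lintegral_decayWeight_sub_left (a : Rd d) :
    ∫⁻ v, decayWeight (a - v) = ∫⁻ v : Rd d, decayWeight v :=
  lintegral_sub_left_eq_self _ a

/-- The gradient `∇_x Φ`. -/
noncomputable def gradX (Φ : Rd d × Rd d → ℝ) (c : Rd d × Rd d) : Rd d :=
  WithLp.toLp 2 fun i => fderiv ℝ Φ c (dirX i)

/-- The gradient `∇_η Φ`. -/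
noncomputable def gradEta (Φ : Rd d × Rd d → ℝ) (c : Rd d × Rd d) : Rd d :=
  WithLp.toLp 2 fun i => fderiv ℝ Φ c (dirEta i)

lemma fderiv_eq_euclPairing (Φ : Rd d × Rd d → ℝ) (c q : Rd d × Rd d) :
    fderiv ℝ Φ c q = euclPairing d q (gradX Φ c, gradEta Φ c) := by
  conv_lhs => rw [← sum_coord_smul q]
  rw [map_sum, Fintype.sum_sum_type, euclPairing_apply, PiLp.inner_apply, PiLp.inner_apply]
  simp [coord, coordDir, gradX, gradEta, mul_comm]

lemma contDiff_toLp_fderiv {Φ : Rd d × Rd d → ℝ} (hΦ : ContDiff ℝ ∞ Φ)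
    (e : Fin d → Rd d × Rd d) :
    ContDiff ℝ 1 fun c => (WithLp.toLp 2 fun i => fderiv ℝ Φ c (e i) : Rd d) := by
  rw [contDiff_euclidean]
  intro i
  exact (hΦ.fderiv_right (m := 1) (by norm_cast)).clm_apply contDiff_const

lemma contDiff_gradX {Φ : Rd d × Rd d → ℝ} (hΦ : ContDiff ℝ ∞ Φ) : ContDiff ℝ 1 (gradX Φ) :=
  contDiff_toLp_fderiv hΦ dirX

lemma contDiff_gradEta {Φ : Rd d × Rd d → ℝ} (hΦ : ContDiff ℝ ∞ Φ) : ContDiff ℝ 1 (gradEta Φ) :=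
  contDiff_toLp_fderiv hΦ dirEta

lemma fderiv_toLp_fderiv_apply {Φ : Rd d × Rd d → ℝ} (hΦ : ContDiff ℝ ∞ Φ)
    (e : Fin d → Rd d × Rd d) (c v : Rd d × Rd d) (i : Fin d) :
    fderiv ℝ (fun c => (WithLp.toLp 2 fun i => fderiv ℝ Φ c (e i) : Rd d)) c v i
      = fderiv ℝ (fderiv ℝ Φ) c v (e i) := by
  have hd : DifferentiableAt ℝ (fderiv ℝ Φ) c :=
    (hΦ.fderiv_right (m := 1) (by norm_cast)).differentiable one_ne_zero c
  have h1 := ((contDiff_toLp_fderiv hΦ e).differentiable one_ne_zero c).hasFDerivAt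
  have h2 := (EuclideanSpace.proj i : Rd d →L[ℝ] ℝ).hasFDerivAt.comp c h1
  have h3 : fderiv ℝ (fun c => fderiv ℝ Φ c (e i)) c = _ := h2.fderiv
  have h4 : fderiv ℝ (fun c => fderiv ℝ Φ c (e i)) c v = fderiv ℝ (fderiv ℝ Φ) c v (e i) := by
    rw [fderiv_clm_apply hd (differentiableAt_const _)]
    simp
  rw [← h4, h3]
  rfl

/-- For fixed `x`, the Jacobian matrix of `η ↦ ∇_x Φ (x, η)` is the mixed Hessian. -/
lemma lintegral_comp_gradX_le {Φ : Rd d × Rd d → ℝ} (hΦ : ContDiff ℝ ∞ Φ) {M δ : ℝ} (hδ : 0 < δ)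
    (hM : ∀ z i l, |mixedHessian Φ z i l| ≤ M) (hdet : ∀ z, δ < |(mixedHessian Φ z).det|)
    (a : Rd d) (g : Rd d → ℝ≥0∞) :
    ∫⁻ b, g (gradX Φ (a, b)) ≤ ENNReal.ofReal δ⁻¹ * ∫⁻ v, g v := by
  refine lintegral_comp_le_of_jacobian (F := fun b => gradX Φ (a, b))
    ((contDiff_gradX hΦ).comp (by fun_prop)) (J := fun b => mixedHessian Φ (a, b)) ?_ hδ
    (fun b => hM _) (fun b => hdet _) g
  intro b i l
  have h : HasFDerivAt (fun b : Rd d => (a, b)) (ContinuousLinearMap.inr ℝ (Rd d) (Rd d)) b :=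
    hasFDerivAt_prodMk_right a b
  have h2 : HasFDerivAt (gradX Φ) _ (a, b) :=
    ((contDiff_gradX hΦ).differentiable one_ne_zero (a, b)).hasFDerivAt
  have h3 : fderiv ℝ (fun b => gradX Φ (a, b)) b = _ := (HasFDerivAt.comp b h2 h).fderiv
  rw [h3, mixedHessian_apply hΦ]
  exact (fderiv_toLp_fderiv_apply hΦ dirX (a, b) _ i).symm

/-- For fixed `η`, the Jacobian matrix of `x ↦ ∇_η Φ (x, η)` is the transposed mixed Hessian. -/
lemma lintegral_comp_gradEta_le {Φ : Rd d × Rd d → ℝ} (hΦ : ContDiff ℝ ∞ Φ) {M δ : ℝ} (hδ : 0 < δ)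
    (hM : ∀ z i l, |mixedHessian Φ z i l| ≤ M) (hdet : ∀ z, δ < |(mixedHessian Φ z).det|)
    (b : Rd d) (g : Rd d → ℝ≥0∞) :
    ∫⁻ a, g (gradEta Φ (a, b)) ≤ ENNReal.ofReal δ⁻¹ * ∫⁻ v, g v := by
  refine lintegral_comp_le_of_jacobian (F := fun a => gradEta Φ (a, b))
    ((contDiff_gradEta hΦ).comp (by fun_prop))
    (J := fun a => (mixedHessian Φ (a, b)).transpose) ?_ hδ
    (fun a i l => hM _ _ _) (fun a => by rw [Matrix.det_transpose]; exact hdet _) g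
  intro a i l
  have h : HasFDerivAt (fun a : Rd d => (a, b)) (ContinuousLinearMap.inl ℝ (Rd d) (Rd d)) a :=
    hasFDerivAt_prodMk_left a b
  have h2 : HasFDerivAt (gradEta Φ) _ (a, b) :=
    ((contDiff_gradEta hΦ).differentiable one_ne_zero (a, b)).hasFDerivAt
  have hs : IsSymmSndFDerivAt ℝ Φ (a, b) :=
    hΦ.contDiffAt.isSymmSndFDerivAt (by
      rw [minSmoothness_of_isRCLikeNormedField]
      exact WithTop.coe_le_coe.2 le_top)
  have h3 : fderiv ℝ (fun a => gradEta Φ (a, b)) a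
      = (fderiv ℝ (gradEta Φ) (a, b)).comp (ContinuousLinearMap.inl ℝ (Rd d) (Rd d)) :=
    (HasFDerivAt.comp (f := fun a : Rd d => (a, b)) a h2 h).fderiv
  rw [h3, Matrix.transpose_apply, mixedHessian_apply hΦ, hs.eq]
  exact (fderiv_toLp_fderiv_apply hΦ dirEta (a, b) _ i).symm

/-- The kernel from the phase space of the output, with variable `(x', η')`, to the points `(x, η)`
at which phase and symbol are localized: it is concentrated near `x' = x`, `η' = ∇_x Φ (x, η)`. -/
noncomputable def outKernel (Φ : Rd d × Rd d → ℝ) (z c : Rd d × Rd d) : ℝ≥0∞ :=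
  decayWeight (c.1 - z.1) * decayWeight (z.2 - gradX Φ c)

/-- The kernel from the points `(x, η)` at which phase and symbol are localized to the phase space
of the input, with variable `(y, ω)`: it is concentrated near `y = ∇_η Φ (x, η)`, `ω = η`. -/
noncomputable def inKernel (Φ : Rd d × Rd d → ℝ) (c w : Rd d × Rd d) : ℝ≥0∞ :=
  decayWeight (c.2 - w.2) * decayWeight (w.1 - gradEta Φ c)

lemma measurable_outKernel {Φ : Rd d × Rd d → ℝ} (hΦ : ContDiff ℝ ∞ Φ) :
    Measurable (Function.uncurry (outKernel Φ)) := by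
  have hg := (contDiff_gradX hΦ).continuous
  have hw := (continuous_decayWeight (d := d)).measurable
  refine (hw.comp (Continuous.measurable ?_)).mul (hw.comp (Continuous.measurable ?_)) <;> fun_prop

lemma measurable_inKernel {Φ : Rd d × Rd d → ℝ} (hΦ : ContDiff ℝ ∞ Φ) :
    Measurable (Function.uncurry (inKernel Φ)) := by
  have hg := (contDiff_gradEta hΦ).continuous
  have hw := (continuous_decayWeight (d := d)).measurable
  refine (hw.comp (Continuous.measurable ?_)).mul (hw.comp (Continuous.measurable ?_)) <;> fun_prop

/-- The common Schur bound of `outKernel` and `inKernel`. -/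
noncomputable def schurConst (d : ℕ) (δ : ℝ) : ℝ≥0∞ :=
  (∫⁻ v : Rd d, decayWeight v) ^ 2 * (1 + ENNReal.ofReal δ⁻¹)

lemma schurConst_lt_top (d : ℕ) (δ : ℝ) : schurConst d δ < ⊤ :=
  ENNReal.mul_lt_top (ENNReal.pow_lt_top lintegral_decayWeight_lt_top)
    (ENNReal.add_lt_top.2 ⟨ENNReal.one_lt_top, ENNReal.ofReal_lt_top⟩)

lemma le_schurConst_left (d : ℕ) (δ : ℝ) :
    (∫⁻ v : Rd d, decayWeight v) * ∫⁻ v : Rd d, decayWeight v ≤ schurConst d δ := by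
  rw [schurConst, sq]
  exact le_mul_of_one_le_right' le_self_add

lemma le_schurConst_right (d : ℕ) (δ : ℝ) :
    (∫⁻ v : Rd d, decayWeight v) * (ENNReal.ofReal δ⁻¹ * ∫⁻ v : Rd d, decayWeight v)
      ≤ schurConst d δ := by
  rw [schurConst, sq, mul_left_comm, mul_comm]
  gcongr
  exact le_add_self

lemma lintegral_prod_mul_decayWeight (a b : Rd d) :
    ∫⁻ z : Rd d × Rd d, decayWeight (a - z.1) * decayWeight (z.2 - b)
      = (∫⁻ v : Rd d, decayWeight v) * ∫⁻ v : Rd d, decayWeight v := by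
  have hw := (continuous_decayWeight (d := d))
  rw [Measure.volume_eq_prod, lintegral_prod_mul (f := fun x => decayWeight (a - x))
    (g := fun y => decayWeight (y - b)) (hw.comp (by fun_prop)).aemeasurable
    (hw.comp (by fun_prop)).aemeasurable, lintegral_decayWeight_sub_right,
    lintegral_decayWeight_sub_left]

lemma lintegral_outKernel_left_le (Φ : Rd d × Rd d → ℝ) (δ : ℝ) (c : Rd d × Rd d) :
    ∫⁻ z, outKernel Φ z c ≤ schurConst d δ := by
  simp only [outKernel]
  rw [lintegral_prod_mul_decayWeight]
  exact le_schurConst_left d δ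

lemma lintegral_inKernel_right_le (Φ : Rd d × Rd d → ℝ) (δ : ℝ) (c : Rd d × Rd d) :
    ∫⁻ w, inKernel Φ c w ≤ schurConst d δ := by
  have h := lintegral_prod_mul_decayWeight c.2 (gradEta Φ c)
  have hw := (continuous_decayWeight (d := d))
  have : ∫⁻ w, inKernel Φ c w = ∫⁻ z : Rd d × Rd d, decayWeight (c.2 - z.1) *
      decayWeight (z.2 - gradEta Φ c) := by
    simp only [inKernel, Measure.volume_eq_prod]
    rw [← lintegral_prod_swap]
    rfl
  rw [this, h]
  exact le_schurConst_left d δ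

lemma lintegral_outKernel_right_le {Φ : Rd d × Rd d → ℝ} (hΦ : ContDiff ℝ ∞ Φ) {M δ : ℝ}
    (hδ : 0 < δ) (hM : ∀ z i l, |mixedHessian Φ z i l| ≤ M)
    (hdet : ∀ z, δ < |(mixedHessian Φ z).det|) (z : Rd d × Rd d) :
    ∫⁻ c, outKernel Φ z c ≤ schurConst d δ := by
  have htop : ENNReal.ofReal δ⁻¹ * ∫⁻ v : Rd d, decayWeight v ≠ ⊤ :=
    ENNReal.mul_ne_top ENNReal.ofReal_ne_top lintegral_decayWeight_lt_top.ne
  have hm := (measurable_outKernel hΦ).comp (measurable_prodMk_left (x := z))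
  have hm' : Measurable (outKernel Φ z) := hm
  rw [Measure.volume_eq_prod, lintegral_prod _ hm'.aemeasurable]
  calc ∫⁻ a, ∫⁻ b, outKernel Φ z (a, b)
      ≤ ∫⁻ a, decayWeight (a - z.1) * (ENNReal.ofReal δ⁻¹ * ∫⁻ v : Rd d, decayWeight v) := by
        gcongr with a
        simp only [outKernel]
        rw [lintegral_const_mul' _ _ (decayWeight_ne_top _)]
        gcongr
        have h := lintegral_comp_gradX_le hΦ hδ hM hdet a fun v => decayWeight (z.2 - v)
        rwa [lintegral_decayWeight_sub_left] at h
    _ = (∫⁻ v : Rd d, decayWeight v) * (ENNReal.ofReal δ⁻¹ * ∫⁻ v : Rd d, decayWeight v) := by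
        rw [lintegral_mul_const' _ _ htop, lintegral_decayWeight_sub_right]
    _ ≤ schurConst d δ := le_schurConst_right d δ

lemma lintegral_inKernel_left_le {Φ : Rd d × Rd d → ℝ} (hΦ : ContDiff ℝ ∞ Φ) {M δ : ℝ}
    (hδ : 0 < δ) (hM : ∀ z i l, |mixedHessian Φ z i l| ≤ M)
    (hdet : ∀ z, δ < |(mixedHessian Φ z).det|) (w : Rd d × Rd d) :
    ∫⁻ c, inKernel Φ c w ≤ schurConst d δ := by
  have htop : ENNReal.ofReal δ⁻¹ * ∫⁻ v : Rd d, decayWeight v ≠ ⊤ :=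
    ENNReal.mul_ne_top ENNReal.ofReal_ne_top lintegral_decayWeight_lt_top.ne
  have hm := (measurable_inKernel hΦ).comp (measurable_prodMk_right (y := w))
  have hm' : Measurable fun c => inKernel Φ c w := hm
  rw [Measure.volume_eq_prod, lintegral_prod_symm _ hm'.aemeasurable]
  calc ∫⁻ b, ∫⁻ a, inKernel Φ (a, b) w
      ≤ ∫⁻ b, decayWeight (b - w.2) * (ENNReal.ofReal δ⁻¹ * ∫⁻ v : Rd d, decayWeight v) := by
        gcongr with b
        simp only [inKernel]
        rw [lintegral_const_mul' _ _ (decayWeight_ne_top _)]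
        gcongr
        have h := lintegral_comp_gradEta_le hΦ hδ hM hdet b fun v => decayWeight (w.1 - v)
        rwa [lintegral_decayWeight_sub_left] at h
    _ = (∫⁻ v : Rd d, decayWeight v) * (ENNReal.ofReal δ⁻¹ * ∫⁻ v : Rd d, decayWeight v) := by
        rw [lintegral_mul_const' _ _ htop, lintegral_decayWeight_sub_right]
    _ ≤ schurConst d δ := le_schurConst_right d δ

/-- The composition of the two kernels is bounded on every `L^p`. -/
theorem eLpNorm_outKernel_inKernel_le {Φ : Rd d × Rd d → ℝ} (hΦ : ContDiff ℝ ∞ Φ) {M δ : ℝ}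
    (hδ : 0 < δ) (hM : ∀ z i l, |mixedHessian Φ z i l| ≤ M)
    (hdet : ∀ z, δ < |(mixedHessian Φ z).det|) {f : Rd d × Rd d → ℝ≥0∞} (hf : Measurable f)
    {p : ℝ≥0∞} (hp : 1 ≤ p) :
    eLpNorm (fun z => ∫⁻ c, outKernel Φ z c * ∫⁻ w, inKernel Φ c w * f w) p volume
      ≤ schurConst d δ ^ 2 * eLpNorm f p volume := by
  have hm : Measurable fun c => ∫⁻ w, inKernel Φ c w * f w :=
    Measurable.lintegral_prod_right ((measurable_inKernel hΦ).mul (hf.comp measurable_snd))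
  refine (eLpNorm_lintegral_kernel_le (measurable_outKernel hΦ) hm
    (lintegral_outKernel_right_le hΦ hδ hM hdet) (lintegral_outKernel_left_le Φ δ) hp).trans ?_
  rw [sq, mul_assoc]
  gcongr
  exact eLpNorm_lintegral_kernel_le (measurable_inKernel hΦ) hf
    (lintegral_inKernel_right_le Φ δ) (lintegral_inKernel_left_le hΦ hδ hM hdet) hp

end Kernels

/-! ### Derivative bounds for the localized amplitude -/

section Amplitude

variable {d : ℕ}

lemma norm_iteratedFDeriv_mul_le_of_bounds {V : Type*} [NormedAddCommGroup V] [NormedSpace ℝ V]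
    {f g : V → ℂ} (hf : ContDiff ℝ ∞ f) (hg : ContDiff ℝ ∞ g) {m : ℕ} {z : V} {A B : ℝ}
    (hA : ∀ k ≤ m, ‖iteratedFDeriv ℝ k f z‖ ≤ A) (hB : ∀ k ≤ m, ‖iteratedFDeriv ℝ k g z‖ ≤ B) :
    ∀ k ≤ m, ‖iteratedFDeriv ℝ k (fun y => f y * g y) z‖ ≤ 2 ^ m * (A * B) := by
  intro k hk
  have hA0 : 0 ≤ A := (norm_nonneg _).trans (hA 0 (Nat.zero_le _))
  have hB0 : 0 ≤ B := (norm_nonneg _).trans (hB 0 (Nat.zero_le _))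
  refine (norm_iteratedFDeriv_mul_le hf hg z (n := k) (WithTop.coe_le_coe.2 le_top)).trans ?_
  calc ∑ i ∈ Finset.range (k + 1), (k.choose i : ℝ) * ‖iteratedFDeriv ℝ i f z‖ *
        ‖iteratedFDeriv ℝ (k - i) g z‖
      ≤ ∑ i ∈ Finset.range (k + 1), (k.choose i : ℝ) * (A * B) := by
        refine Finset.sum_le_sum fun i hi => ?_
        rw [mul_assoc]
        have : i ≤ k := Nat.lt_succ_iff.1 (Finset.mem_range.1 hi)
        gcongr
        · exact hA i (this.trans hk)
        · exact hB _ ((Nat.sub_le _ _).trans hk)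
    _ = 2 ^ k * (A * B) := by
        rw [← Finset.sum_mul]
        congr 1
        exact_mod_cast Nat.sum_range_choose k
    _ ≤ 2 ^ m * (A * B) := by gcongr; norm_num

/-- Derivative bounds for a Schwartz function of one component of the variable. -/
lemma exists_schwartz_comp_bound (γ : 𝓢(Rd d, ℂ)) (T : (Rd d × Rd d) →L[ℝ] Rd d) (hT : ‖T‖ ≤ 1)
    (n m : ℕ) {r : ℝ} (hr : 0 ≤ r) :
    ∃ S : ℝ, 0 ≤ S ∧ ∀ (a : Rd d) (c z : Rd d × Rd d), ‖z - c‖ ≤ r → ∀ k ≤ m,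
      ‖iteratedFDeriv ℝ k (fun q => γ (T q - a)) z‖ ≤ S * ((1 + ‖T c - a‖) ^ n)⁻¹ := by
  set S₀ := 2 ^ n * ((Finset.Iic (n, m)).sup fun m => SchwartzMap.seminorm ℝ m.1 m.2) γ with hS₀
  have hS₀0 : 0 ≤ S₀ := by positivity
  refine ⟨(1 + r) ^ n * S₀, by positivity, fun a c z hz k hk => ?_⟩
  have hγ : ContDiff ℝ ∞ fun y => γ (y - a) := (γ.smooth ⊤).comp (contDiff_id.sub contDiff_const)
  have h1 : ‖iteratedFDeriv ℝ k (fun q => γ (T q - a)) z‖ ≤ ‖iteratedFDeriv ℝ k γ (T z - a)‖ := by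
    have h := T.iteratedFDeriv_comp_right hγ z (i := k) (WithTop.coe_le_coe.2 le_top)
    change ‖iteratedFDeriv ℝ k ((fun y => γ (y - a)) ∘ T) z‖ ≤ _
    rw [h, iteratedFDeriv_comp_sub]
    refine (ContinuousMultilinearMap.norm_compContinuousLinearMap_le _ _).trans ?_
    refine mul_le_of_le_one_right (norm_nonneg _) ?_
    exact Finset.prod_le_one (fun _ _ => norm_nonneg _) fun _ _ => hT
  have h2 : (1 + ‖T z - a‖) ^ n * ‖iteratedFDeriv ℝ k γ (T z - a)‖ ≤ S₀ :=
    SchwartzMap.one_add_le_sup_seminorm_apply (𝕜 := ℝ) (m := (n, m)) le_rfl hk γ (T z - a)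
  have h3 : 1 + ‖T c - a‖ ≤ (1 + r) * (1 + ‖T z - a‖) := by
    have h4 : ‖T c - a‖ ≤ ‖T z - a‖ + r := by
      have h5 : T c - a = (T z - a) - T (z - c) := by rw [map_sub]; abel
      rw [h5]
      refine (norm_sub_le _ _).trans (add_le_add le_rfl ?_)
      calc ‖T (z - c)‖ ≤ ‖T‖ * ‖z - c‖ := T.le_opNorm _
        _ ≤ 1 * r := by gcongr
        _ = r := one_mul r
    nlinarith [norm_nonneg (T z - a)]
  rw [← div_eq_mul_inv, le_div_iff₀ (by positivity)]
  calc ‖iteratedFDeriv ℝ k (fun q => γ (T q - a)) z‖ * (1 + ‖T c - a‖) ^ n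
      ≤ ‖iteratedFDeriv ℝ k γ (T z - a)‖ * ((1 + r) * (1 + ‖T z - a‖)) ^ n := by gcongr
    _ = (1 + r) ^ n * ((1 + ‖T z - a‖) ^ n * ‖iteratedFDeriv ℝ k γ (T z - a)‖) := by
        rw [mul_pow]; ring
    _ ≤ (1 + r) ^ n * S₀ := by gcongr

/-- The remainder of the first-order Taylor expansion of the phase at `c`. -/
noncomputable def taylorRem (Φ : Rd d × Rd d → ℝ) (c q : Rd d × Rd d) : ℝ :=
  Φ q - Φ c - fderiv ℝ Φ c (q - c)

lemma contDiff_taylorRem {Φ : Rd d × Rd d → ℝ} (hΦ : ContDiff ℝ ∞ Φ) (c : Rd d × Rd d) :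
    ContDiff ℝ ∞ (taylorRem Φ c) :=
  (hΦ.sub contDiff_const).sub
    ((fderiv ℝ Φ c).contDiff.comp (contDiff_id.sub contDiff_const))

lemma fderiv_taylorRem {Φ : Rd d × Rd d → ℝ} (hΦ : ContDiff ℝ ∞ Φ) (c : Rd d × Rd d) :
    fderiv ℝ (taylorRem Φ c) = fderiv ℝ Φ - fun _ => fderiv ℝ Φ c := by
  funext q
  have h1 : HasFDerivAt Φ (fderiv ℝ Φ q) q :=
    (hΦ.differentiable (by simp) q).hasFDerivAt
  have h2 : HasFDerivAt (fun q => fderiv ℝ Φ c (q - c)) (fderiv ℝ Φ c) q := by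
    exact (fderiv ℝ Φ c).hasFDerivAt.comp q ((hasFDerivAt_id q).sub_const c)
  exact ((h1.sub_const (Φ c)).sub h2).fderiv

/-- On a ball where the derivatives of `Φ` of order at least two are bounded, all derivatives of
positive order of the Taylor remainder are bounded: the affine part only affects the first one. -/
lemma norm_iteratedFDeriv_taylorRem_le {Φ : Rd d × Rd d → ℝ} (hΦ : ContDiff ℝ ∞ Φ)
    {c : Rd d × Rd d} {r M : ℝ} (hr : 0 ≤ r) (hM : 1 ≤ M) {m : ℕ} (hm : 2 ≤ m)
    (hb : ∀ z ∈ Metric.closedBall c r, ∀ k, 2 ≤ k → k ≤ m → ‖iteratedFDeriv ℝ k Φ z‖ ≤ M)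
    {z : Rd d × Rd d} (hz : z ∈ Metric.closedBall c r) {k : ℕ} (hk1 : 1 ≤ k) (hk : k ≤ m) :
    ‖iteratedFDeriv ℝ k (taylorRem Φ c) z‖ ≤ M * (1 + r) := by
  have hM0 : 0 ≤ M := zero_le_one.trans hM
  have hdΦ : ContDiff ℝ ∞ (fderiv ℝ Φ) := hΦ.fderiv_right (by simp)
  obtain ⟨j, rfl⟩ := Nat.exists_eq_add_of_le' hk1
  rw [← norm_iteratedFDeriv_fderiv, fderiv_taylorRem hΦ]
  rcases Nat.eq_zero_or_pos j with rfl | hj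
  · rw [norm_iteratedFDeriv_zero]
    have h := (convex_closedBall c r).norm_image_sub_le_of_norm_fderiv_le (𝕜 := ℝ)
      (f := fderiv ℝ Φ) (C := M) (x := c) (y := z)
      (fun y _ => hdΦ.differentiable (by simp) y) (fun y hy => by
        have h2 := hb y hy 2 le_rfl hm
        rw [← norm_iteratedFDeriv_fderiv, ← norm_iteratedFDeriv_fderiv,
          norm_iteratedFDeriv_zero] at h2
        exact h2) (Metric.mem_closedBall_self hr) hz
    refine h.trans (mul_le_mul_of_nonneg_left ?_ hM0)
    rw [← dist_eq_norm]
    exact (Metric.mem_closedBall.1 hz).trans (by linarith)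
  · rw [iteratedFDeriv_sub_apply (hdΦ.contDiffAt.of_le (WithTop.coe_le_coe.2 le_top))
      contDiffAt_const, iteratedFDeriv_const_of_ne hj.ne', Pi.zero_apply, sub_zero,
      norm_iteratedFDeriv_fderiv]
    exact (hb z hz (j + 1) (by omega) hk).trans (le_mul_of_one_le_right hM0 (by linarith))

lemma norm_iteratedFDeriv_exp_line_le (k m : ℕ) (hk : k ≤ m) (s : ℝ) :
    ‖iteratedFDeriv ℝ k (fun s : ℝ => Complex.exp (-(2 * Real.pi * Complex.I) * (s : ℂ))) s‖
      ≤ (2 * Real.pi) ^ m := by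
  rw [norm_iteratedFDeriv_eq_norm_iteratedDeriv, iteratedDeriv_osc_line, norm_mul, norm_pow,
    norm_neg, Complex.norm_exp]
  have h1 : ‖(2 * Real.pi * Complex.I : ℂ)‖ = 2 * Real.pi := by
    simp [abs_of_pos Real.pi_pos]
  rw [h1]
  have h2 : (-(2 * Real.pi * Complex.I) * (s : ℂ)).re = 0 := by simp
  rw [h2, Real.exp_zero, mul_one]
  exact pow_le_pow_right₀ (by linarith [Real.pi_gt_three]) hk

lemma contDiff_exp_line :
    ContDiff ℝ ∞ fun s : ℝ => Complex.exp (-(2 * Real.pi * Complex.I) * (s : ℂ)) :=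
  Complex.contDiff_exp.comp (contDiff_const.mul Complex.ofRealCLM.contDiff)

/-- The amplitude which remains after localizing near `c` and removing from the phase its affine
part at `c`; `γ` and `θ` are the analysis window and the Fourier transform of the synthesis
window. -/
noncomputable def amplitude (Φ : Rd d × Rd d → ℝ) (σ ψ : Rd d × Rd d → ℂ) (γ θ : 𝓢(Rd d, ℂ))
    (c : Rd d × Rd d) (x ν : Rd d) (q : Rd d × Rd d) : ℂ :=
  Complex.exp (-(2 * Real.pi * Complex.I) * ((-taylorRem Φ c q : ℝ) : ℂ)) *
    (σ q * (ψ (q - c) * (γ (q.1 - x) * θ (q.2 - ν))))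

lemma contDiff_amplitude {Φ : Rd d × Rd d → ℝ} {σ ψ : Rd d × Rd d → ℂ} (hΦ : ContDiff ℝ ∞ Φ)
    (hσ : ContDiff ℝ ∞ σ) (hψ : ContDiff ℝ ∞ ψ) (γ θ : 𝓢(Rd d, ℂ)) (c : Rd d × Rd d)
    (x ν : Rd d) : ContDiff ℝ ∞ (amplitude Φ σ ψ γ θ c x ν) := by
  refine (contDiff_exp_line.comp (contDiff_taylorRem hΦ c).neg).mul (hσ.mul (ContDiff.mul ?_
    (ContDiff.mul ?_ ?_)))
  · exact hψ.comp (contDiff_id.sub contDiff_const)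
  · exact (γ.smooth ⊤).comp (contDiff_fst.sub contDiff_const)
  · exact (θ.smooth ⊤).comp (contDiff_snd.sub contDiff_const)

lemma tsupport_amplitude_subset {Φ : Rd d × Rd d → ℝ} {σ ψ : Rd d × Rd d → ℂ} {r : ℝ}
    (hψr : tsupport ψ ⊆ Metric.closedBall 0 r) (γ θ : 𝓢(Rd d, ℂ)) (c : Rd d × Rd d)
    (x ν : Rd d) : tsupport (amplitude Φ σ ψ γ θ c x ν) ⊆ tsupport σ ∩ Metric.closedBall c r := by
  refine Set.subset_inter ?_ ?_
  · refine closure_mono fun q hq => ?_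
    rw [Function.mem_support] at hq ⊢
    contrapose! hq
    simp [amplitude, hq]
  · refine closure_minimal (fun q hq => ?_) Metric.isClosed_closedBall
    rw [Function.mem_support] at hq
    have : ψ (q - c) ≠ 0 := by
      contrapose! hq
      simp [amplitude, hq]
    have := hψr (subset_tsupport _ this)
    rwa [mem_closedBall_zero_iff, ← dist_eq_norm] at this

lemma closedBall_subset_euclNhd {ε : ℝ} (hε : 0 < ε) {S : Set (Rd d × Rd d)} {c w : Rd d × Rd d}
    (hw : w ∈ S) (hwc : w ∈ Metric.closedBall c (ε / 4)) :
    Metric.closedBall c (ε / 4) ⊆ euclNhd ε S := by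
  intro z hz
  refine ⟨w, hw, ?_⟩
  have h : ‖z - w‖ ≤ ε / 2 := by
    rw [← dist_eq_norm]
    have := dist_triangle_right z w c
    rw [Metric.mem_closedBall] at hz hwc
    linarith
  have h1 : ‖z.1 - w.1‖ ≤ ε / 2 := (norm_fst_le (z - w)).trans h
  have h2 : ‖z.2 - w.2‖ ≤ ε / 2 := (norm_snd_le (z - w)).trans h
  nlinarith [norm_nonneg (z.1 - w.1), norm_nonneg (z.2 - w.2)]

/-- The derivatives of the amplitude are uniformly bounded, with decay in the distance from `c` to
the centres of the two windows. When the ball around `c` misses `supp σ`, so that the phase is not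
controlled there, the amplitude vanishes. -/
theorem exists_amplitude_bound (n : ℕ) {m : ℕ} (hm : 2 ≤ m) {ε M : ℝ} (hε : 0 < ε) (hM : 1 ≤ M)
    {ψ : Rd d × Rd d → ℂ} (hψ : ContDiff ℝ ∞ ψ)
    (hψr : tsupport ψ ⊆ Metric.closedBall 0 (ε / 4)) (γ θ : 𝓢(Rd d, ℂ)) :
    ∃ B : ℝ, 0 ≤ B ∧ ∀ (σ : Rd d × Rd d → ℂ) (Φ : Rd d × Rd d → ℝ), ContDiff ℝ ∞ σ →
      ContDiff ℝ ∞ Φ → (∀ z, ∀ k ≤ m, ‖iteratedFDeriv ℝ k σ z‖ ≤ M) →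
      (∀ z ∈ euclNhd ε (tsupport σ), ∀ k, 2 ≤ k → k ≤ m → ‖iteratedFDeriv ℝ k Φ z‖ ≤ M) →
      ∀ c x ν, ∀ k ≤ m, ∀ z, ‖iteratedFDeriv ℝ k (amplitude Φ σ ψ γ θ c x ν) z‖
        ≤ B * (((1 + ‖c.1 - x‖) ^ n)⁻¹ * ((1 + ‖c.2 - ν‖) ^ n)⁻¹) := by
  have hr : 0 ≤ ε / 4 := by positivity
  have hM0 : 0 ≤ M := zero_le_one.trans hM
  obtain ⟨S, hS0, hS⟩ := exists_schwartz_comp_bound γ (.fst ℝ (Rd d) (Rd d))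
    (ContinuousLinearMap.norm_fst_le ..) n m hr
  obtain ⟨T, hT0, hT⟩ := exists_schwartz_comp_bound θ (.snd ℝ (Rd d) (Rd d))
    (ContinuousLinearMap.norm_snd_le ..) n m hr
  have hcs : HasCompactSupport ψ :=
    (isCompact_closedBall _ _).of_isClosed_subset (isClosed_tsupport ψ) hψr
  have hex : ∀ k : ℕ, ∃ P, ∀ z, ‖iteratedFDeriv ℝ k ψ z‖ ≤ P := fun k =>
    (hcs.iteratedFDeriv k).exists_bound_of_continuous
      (hψ.continuous_iteratedFDeriv (WithTop.coe_le_coe.2 le_top))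
  choose P hP using hex
  have hP0 : ∀ k, 0 ≤ P k := fun k => (norm_nonneg _).trans (hP k 0)
  set Q := ∑ k ∈ Finset.range (m + 1), P k with hQ
  have hQ0 : 0 ≤ Q := Finset.sum_nonneg fun k _ => hP0 k
  have hPQ : ∀ k ≤ m, P k ≤ Q := fun k hk =>
    Finset.single_le_sum (f := P) (fun k _ => hP0 k) (Finset.mem_range.2 (Nat.lt_succ_of_le hk))
  set D := M * (1 + ε / 4) with hD
  have hD1 : 1 ≤ D := by rw [hD]; nlinarith
  set X := (m.factorial : ℝ) * (2 * Real.pi) ^ m * D ^ m with hX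
  have hX0 : 0 ≤ X := by positivity
  refine ⟨2 ^ m * (X * (2 ^ m * (M * (2 ^ m * (Q * (2 ^ m * (S * T))))))), by positivity, ?_⟩
  intro σ Φ hσ hΦ hσb hΦb c x ν k hk z
  have hsub := tsupport_amplitude_subset (Φ := Φ) (σ := σ) hψr γ θ c x ν
  by_cases hz : z ∈ tsupport (amplitude Φ σ ψ γ θ c x ν)
  swap
  · have : iteratedFDeriv ℝ k (amplitude Φ σ ψ γ θ c x ν) z = 0 := by
      by_contra h
      exact hz (support_iteratedFDeriv_subset k h)
    rw [this, norm_zero]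
    positivity
  obtain ⟨hzσ, hzc⟩ := hsub hz
  have hnhd := closedBall_subset_euclNhd hε hzσ hzc
  have hzc' : ‖z - c‖ ≤ ε / 4 := by rw [← dist_eq_norm]; exact hzc
  have b1 : ∀ k ≤ m, ‖iteratedFDeriv ℝ k (fun q : Rd d × Rd d => γ (q.1 - x)) z‖
      ≤ S * ((1 + ‖c.1 - x‖) ^ n)⁻¹ := fun k hk => hS x c z hzc' k hk
  have b2 : ∀ k ≤ m, ‖iteratedFDeriv ℝ k (fun q : Rd d × Rd d => θ (q.2 - ν)) z‖
      ≤ T * ((1 + ‖c.2 - ν‖) ^ n)⁻¹ := fun k hk => hT ν c z hzc' k hk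
  have b3 : ∀ k ≤ m, ‖iteratedFDeriv ℝ k (fun q => ψ (q - c)) z‖ ≤ Q := fun k hk => by
    rw [iteratedFDeriv_comp_sub]
    exact (hP k _).trans (hPQ k hk)
  have b4 : ∀ k ≤ m, ‖iteratedFDeriv ℝ k (fun q => Complex.exp (-(2 * Real.pi * Complex.I) *
      ((-taylorRem Φ c q : ℝ) : ℂ))) z‖ ≤ X := by
    intro k hk
    have h := norm_iteratedFDeriv_comp_le (n := k) contDiff_exp_line (contDiff_taylorRem hΦ c).neg
      (WithTop.coe_le_coe.2 le_top) z (C := (2 * Real.pi) ^ m) (D := D)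
      (fun i hi => norm_iteratedFDeriv_exp_line_le i m (hi.trans hk) _) (fun i hi1 hi => by
        have h1 := norm_iteratedFDeriv_taylorRem_le hΦ hr hM hm
          (fun y hy => hΦb y (hnhd hy)) hzc hi1 (hi.trans hk)
        change ‖iteratedFDeriv ℝ i (-taylorRem Φ c) z‖ ≤ _
        rw [iteratedFDeriv_neg, Pi.neg_apply, norm_neg]
        exact h1.trans (le_self_pow₀ hD1 (by omega)))
    refine h.trans ?_
    rw [hX]
    gcongr
  have hc1 : ContDiff ℝ ∞ fun q : Rd d × Rd d => γ (q.1 - x) :=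
    (γ.smooth ⊤).comp (contDiff_fst.sub contDiff_const)
  have hc2 : ContDiff ℝ ∞ fun q : Rd d × Rd d => θ (q.2 - ν) :=
    (θ.smooth ⊤).comp (contDiff_snd.sub contDiff_const)
  have hc3 : ContDiff ℝ ∞ fun q => ψ (q - c) := hψ.comp (contDiff_id.sub contDiff_const)
  have hc4 := contDiff_exp_line.comp (contDiff_taylorRem hΦ c).neg
  have r1 := norm_iteratedFDeriv_mul_le_of_bounds hc1 hc2 b1 b2
  have r2 := norm_iteratedFDeriv_mul_le_of_bounds hc3 (hc1.mul hc2) b3 r1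
  have r3 := norm_iteratedFDeriv_mul_le_of_bounds hσ (hc3.mul (hc1.mul hc2)) (hσb z) r2
  have r4 := norm_iteratedFDeriv_mul_le_of_bounds hc4 (hσ.mul (hc3.mul (hc1.mul hc2))) b4 r3 k hk
  refine r4.trans (le_of_eq ?_)
  ring

/-- The matrix coefficient of the operator between two time-frequency shifts, localized near `c`,
is bounded by the product of the two kernels. -/
theorem exists_localized_coefficient_bound {ε M : ℝ} (hε : 0 < ε) (hM : 1 ≤ M)
    {ψ : Rd d × Rd d → ℂ} (hψ : ContDiff ℝ ∞ ψ)
    (hψr : tsupport ψ ⊆ Metric.closedBall 0 (ε / 4)) (γ θ : 𝓢(Rd d, ℂ)) :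
    ∃ C : ℝ≥0, ∀ (σ : Rd d × Rd d → ℂ) (Φ : Rd d × Rd d → ℝ), ContDiff ℝ ∞ σ →
      ContDiff ℝ ∞ Φ → (∀ z, ∀ k ≤ 2 * (d + 1), ‖iteratedFDeriv ℝ k σ z‖ ≤ M) →
      (∀ z ∈ euclNhd ε (tsupport σ), ∀ k, 2 ≤ k → k ≤ 2 * (d + 1) →
        ‖iteratedFDeriv ℝ k Φ z‖ ≤ M) →
      ∀ z c w : Rd d × Rd d,
        ‖∫ q : Rd d × Rd d, Complex.exp (2 * Real.pi * Complex.I * (Φ q : ℝ)) * σ q * ψ (q - c) *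
            (osc z.2 q.1 * γ (q.1 - z.1)) * (osc w.1 (q.2 - w.2) * θ (q.2 - w.2))‖ₑ
          ≤ C * (outKernel Φ z c * inKernel Φ c w) := by
  obtain ⟨B, hB0, hB⟩ := exists_amplitude_bound (d + 1) (m := 2 * (d + 1)) (by omega) hε hM hψ hψr
    γ θ
  obtain ⟨C, hC0, hC⟩ := exists_fourier_decay d (d + 1) (ε / 4)
  refine ⟨⟨C * B, by positivity⟩, fun σ Φ hσ hΦ hσb hΦb z c w => ?_⟩
  set ξ : Rd d × Rd d := (z.2 - gradX Φ c, w.1 - gradEta Φ c) with hξ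
  set W : ℝ := ((1 + ‖c.1 - z.1‖) ^ (d + 1))⁻¹ * ((1 + ‖c.2 - w.2‖) ^ (d + 1))⁻¹ with hW
  have hW0 : 0 ≤ W := by positivity
  have hdecay := hC (amplitude Φ σ ψ γ θ c z.1 w.2) c (B * W)
    (contDiff_amplitude hΦ hσ hψ γ θ c _ _)
    ((tsupport_amplitude_subset hψr γ θ c _ _).trans Set.inter_subset_right) (by positivity)
    (hB σ Φ hσ hΦ hσb hΦb c _ _) ξ
  -- the affine part of the phase at `c` contributes a frequency shift and a constant phase factor
  set u : ℝ := Φ c - euclPairing d c (gradX Φ c, gradEta Φ c) + inner ℝ w.1 w.2 with hu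
  have hint : ∀ q : Rd d × Rd d,
      Complex.exp (2 * Real.pi * Complex.I * (Φ q : ℝ)) * σ q * ψ (q - c) *
        (osc z.2 q.1 * γ (q.1 - z.1)) * (osc w.1 (q.2 - w.2) * θ (q.2 - w.2)) =
      Complex.exp ((2 * Real.pi * u : ℝ) * Complex.I) *
        (Complex.exp (-(2 * Real.pi * Complex.I * (euclPairing d q ξ : ℝ))) *
          amplitude Φ σ ψ γ θ c z.1 w.2 q) := by
    intro q
    have hphase : Complex.exp (2 * Real.pi * Complex.I * (Φ q : ℝ)) * osc z.2 q.1 *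
        osc w.1 (q.2 - w.2) = Complex.exp ((2 * Real.pi * u : ℝ) * Complex.I) *
        Complex.exp (-(2 * Real.pi * Complex.I * (euclPairing d q ξ : ℝ))) *
        Complex.exp (-(2 * Real.pi * Complex.I) * ((-taylorRem Φ c q : ℝ) : ℂ)) := by
      rw [osc, osc, ← Complex.exp_add, ← Complex.exp_add, ← Complex.exp_add, ← Complex.exp_add]
      congr 1
      have hreal : Φ q - inner ℝ z.2 q.1 - inner ℝ w.1 (q.2 - w.2)
          = u - euclPairing d q ξ + taylorRem Φ c q := by
        rw [hu, hξ, taylorRem, fderiv_eq_euclPairing, map_sub, sub_apply,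
          euclPairing_apply, euclPairing_apply, euclPairing_apply]
        simp only [inner_sub_right, real_inner_comm z.2 q.1, real_inner_comm w.1 q.2]
        ring
      have hc := congrArg (fun s : ℝ => 2 * Real.pi * Complex.I * (s : ℂ)) hreal
      push_cast at hc ⊢
      linear_combination hc
    rw [amplitude]
    linear_combination (σ q * ψ (q - c) * γ (q.1 - z.1) * θ (q.2 - w.2)) * hphase
  simp only [hint]
  rw [integral_const_mul, enorm_mul]
  have hone : ‖Complex.exp ((2 * Real.pi * u : ℝ) * Complex.I)‖ₑ = 1 := by
    rw [← ofReal_norm, Complex.norm_exp_ofReal_mul_I, ENNReal.ofReal_one]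
  rw [hone, one_mul, ← ofReal_norm]
  set Y := ‖∫ q, Complex.exp (-(2 * Real.pi * Complex.I * (euclPairing d q ξ : ℝ))) *
    amplitude Φ σ ψ γ θ c z.1 w.2 q‖ with hY
  have hfin : Y ≤ C * B * (((1 + ‖c.1 - z.1‖) ^ (d + 1))⁻¹ *
      ((1 + ‖z.2 - gradX Φ c‖) ^ (d + 1))⁻¹ * (((1 + ‖c.2 - w.2‖) ^ (d + 1))⁻¹ *
      ((1 + ‖w.1 - gradEta Φ c‖) ^ (d + 1))⁻¹)) := by
    rw [← le_div_iff₀ (by positivity)] at hdecay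
    refine hdecay.trans (le_of_eq ?_)
    rw [hW, hξ, div_eq_mul_inv, mul_inv]
    ring
  refine (ENNReal.ofReal_le_ofReal hfin).trans (le_of_eq ?_)
  rw [outKernel, inKernel, decayWeight, decayWeight, decayWeight, decayWeight,
    ← ENNReal.ofReal_mul (by positivity), ← ENNReal.ofReal_mul (by positivity),
    ← ENNReal.ofReal_mul (by positivity), ENNReal.ofReal_mul (by positivity)]
  congr 1
  rw [ENNReal.ofReal, Real.toNNReal_of_nonneg (by positivity)]
  rfl

end Amplitude

/-! ### Reconstruction from the short-time Fourier transform -/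

section Reconstruction

variable {d : ℕ}

lemma norm_osc (a t : Rd d) : ‖osc a t‖ = 1 := by
  have : osc a t = Complex.exp ((-(2 * Real.pi * inner ℝ a t) : ℝ) * Complex.I) := by
    rw [osc]; congr 1; push_cast; ring
  rw [this, Complex.norm_exp_ofReal_mul_I]

lemma continuous_osc_comp {X : Type*} [TopologicalSpace X] {f g : X → Rd d} (hf : Continuous f)
    (hg : Continuous g) : Continuous fun x => osc (f x) (g x) := by
  unfold osc
  fun_prop

lemma osc_comm (a t : Rd d) : osc a t = osc t a := by
  rw [osc, osc, real_inner_comm]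

lemma osc_add (a s t : Rd d) : osc a (s + t) = osc a s * osc a t := by
  rw [osc, osc, osc, ← Complex.exp_add, inner_add_right]
  congr 1
  push_cast
  ring

lemma conj_osc (a t : Rd d) : conj (osc a t) = osc a (-t) := by
  rw [osc, osc, ← Complex.exp_conj, inner_neg_right]
  congr 1
  simp only [map_neg, map_mul, Complex.conj_ofReal, Complex.conj_I, map_ofNat]
  push_cast
  ring

lemma osc_sub_left (s t a : Rd d) : osc (t - s) a = osc t a * conj (osc s a) := by
  rw [conj_osc, osc, osc, osc, ← Complex.exp_add, inner_sub_left, inner_neg_right]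
  congr 1
  push_cast
  ring

lemma fourier_eq_integral_osc (f : 𝓢(Rd d, ℂ)) (η : Rd d) : 𝓕 f η = ∫ t, osc t η * f t := by
  rw [SchwartzMap.fourier_coe, Real.fourier_eq']
  refine integral_congr_ae (Filter.Eventually.of_forall fun t => ?_)
  simp only [osc, smul_eq_mul]
  congr 2
  push_cast
  ring

/-- The pointwise complex conjugate of a Schwartz function. -/
noncomputable def conjSchwartz (g : 𝓢(Rd d, ℂ)) : 𝓢(Rd d, ℂ) :=
  g.postcompCLM (Complex.conjCLE : ℂ →L[ℝ] ℂ)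

lemma conjSchwartz_apply (g : 𝓢(Rd d, ℂ)) (t : Rd d) : conjSchwartz g t = conj (g t) := rfl

lemma conjTFShift_eq (g : 𝓢(Rd d, ℂ)) (x η t : Rd d) :
    conjTFShift g x η t = osc η t * conjSchwartz g (t - x) :=
  conjTFShift_apply g x η t

lemma stft_coe (g u : 𝓢(Rd d, ℂ)) (w : Rd d × Rd d) :
    stft g (u : 𝓢'(Rd d, ℂ)) w = ∫ t, osc w.2 t * conjSchwartz g (t - w.1) * u t := by
  have h := toTemperedDistributionCLM_apply_apply (E := Rd d) (F := ℂ) volume u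
    (conjTFShift g w.1 w.2)
  refine h.trans (integral_congr_ae (Filter.Eventually.of_forall fun t => ?_))
  simp only [smul_eq_mul, conjTFShift_eq]

/-- The integrand of the short-time Fourier transform is integrable jointly in the integration
variable and the translation. -/
lemma integrable_mul_translate (γ u : 𝓢(Rd d, ℂ)) :
    Integrable (fun p : Rd d × Rd d => γ (p.2 - p.1) * u p.2) (volume.prod volume) := by
  have h := u.integrable (μ := volume)
  have h' := (γ.integrable (μ := volume)).comp_neg
  refine (h.convolution_integrand (ContinuousLinearMap.mul ℂ ℂ) h').congr
    (Filter.Eventually.of_forall fun p => ?_)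
  simp [mul_comm]

/-- A bound for the short-time Fourier transform which does not depend on the frequency. -/
noncomputable def stftBound (g u : 𝓢(Rd d, ℂ)) (y : Rd d) : ℝ :=
  ∫ t, ‖conjSchwartz g (t - y) * u t‖

lemma integrable_stftBound (g u : 𝓢(Rd d, ℂ)) : Integrable (stftBound g u) :=
  (integrable_mul_translate (conjSchwartz g) u).norm.integral_prod_left

lemma norm_stft_le (g u : 𝓢(Rd d, ℂ)) (w : Rd d × Rd d) :
    ‖stft g (u : 𝓢'(Rd d, ℂ)) w‖ ≤ stftBound g u w.1 := by
  rw [stft_coe]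
  refine (norm_integral_le_integral_norm _).trans (le_of_eq ?_)
  refine integral_congr_ae (Filter.Eventually.of_forall fun t => ?_)
  simp [mul_assoc, norm_osc]

lemma continuous_stft (g u : 𝓢(Rd d, ℂ)) :
    Continuous fun w => stft g (u : 𝓢'(Rd d, ℂ)) w := by
  simp only [stft_coe]
  obtain ⟨B, hB⟩ : ∃ B, ∀ t, ‖conjSchwartz g t‖ ≤ B :=
    ⟨_, fun t => SchwartzMap.norm_le_seminorm ℝ (conjSchwartz g) t⟩
  have hcw : ∀ w : Rd d × Rd d, Continuous fun t =>
      osc w.2 t * conjSchwartz g (t - w.1) * u t := fun w =>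
    ((continuous_osc_comp continuous_const continuous_id).mul
      ((conjSchwartz g).continuous.comp (continuous_id.sub continuous_const))).mul u.continuous
  have hct : ∀ t : Rd d, Continuous fun w : Rd d × Rd d =>
      osc w.2 t * conjSchwartz g (t - w.1) * u t := fun t =>
    ((continuous_osc_comp continuous_snd continuous_const).mul
      ((conjSchwartz g).continuous.comp (continuous_const.sub continuous_fst))).mul
        continuous_const
  have hb : ∀ (w : Rd d × Rd d) (t : Rd d),
      ‖osc w.2 t * conjSchwartz g (t - w.1) * u t‖ ≤ B * ‖u t‖ := fun w t => by
    rw [norm_mul, norm_mul, norm_osc, one_mul]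
    gcongr
    exact hB _
  exact continuous_of_dominated (fun w => (hcw w).aestronglyMeasurable)
    (fun w => Filter.Eventually.of_forall (hb w))
    ((u.integrable (μ := volume)).norm.const_mul B) (Filter.Eventually.of_forall hct)

/-- Integrating the short-time Fourier transform against an oscillation in the translation variable
gives the product of the Fourier transforms of the function and of the window. -/
lemma integral_stft_mul_osc (g u : 𝓢(Rd d, ℂ)) (ν η : Rd d) :
    ∫ y, stft g (u : 𝓢'(Rd d, ℂ)) (y, ν) * osc y (η - ν) = 𝓕 u η * conj (𝓕 g (η - ν)) := by
  have hinner : ∀ t : Rd d, ∫ y, conjSchwartz g (t - y) * osc y (η - ν)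
      = osc t (η - ν) * conj (𝓕 g (η - ν)) := by
    intro t
    have h := integral_sub_left_eq_self
      (fun s : Rd d => conjSchwartz g s * osc (t - s) (η - ν)) volume t
    simp only [sub_sub_cancel] at h
    rw [h, fourier_eq_integral_osc, ← integral_conj, ← integral_const_mul]
    refine integral_congr_ae (Filter.Eventually.of_forall fun s => ?_)
    simp only [map_mul]
    rw [osc_sub_left, conjSchwartz_apply]
    ring
  have hint : Integrable (Function.uncurry fun y t : Rd d =>
      osc ν t * conjSchwartz g (t - y) * u t * osc y (η - ν)) (volume.prod volume) := by
    refine (integrable_mul_translate (conjSchwartz g) u).mono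
      (Continuous.aestronglyMeasurable ?_) (Filter.Eventually.of_forall fun p => ?_)
    · exact ((((continuous_osc_comp continuous_const continuous_snd).mul
        ((conjSchwartz g).continuous.comp (continuous_snd.sub continuous_fst))).mul
        (u.continuous.comp continuous_snd)).mul
        (continuous_osc_comp continuous_fst continuous_const))
    · simp [Function.uncurry, norm_osc]
  calc ∫ y, stft g (u : 𝓢'(Rd d, ℂ)) (y, ν) * osc y (η - ν)
      = ∫ y, ∫ t, osc ν t * conjSchwartz g (t - y) * u t * osc y (η - ν) := by
        simp only [stft_coe, integral_mul_const]
    _ = ∫ t, ∫ y, osc ν t * conjSchwartz g (t - y) * u t * osc y (η - ν) :=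
        integral_integral_swap hint
    _ = ∫ t, (osc t η * u t) * conj (𝓕 g (η - ν)) := by
        refine integral_congr_ae (Filter.Eventually.of_forall fun t => ?_)
        have h1 : ∀ y, osc ν t * conjSchwartz g (t - y) * u t * osc y (η - ν)
            = osc ν t * u t * (conjSchwartz g (t - y) * osc y (η - ν)) := fun y => by ring
        simp only [h1, integral_const_mul, hinner]
        have h2 : osc t η = osc ν t * osc t (η - ν) := by
          rw [osc_comm ν, ← osc_add, add_sub_cancel]
        rw [h2]
        ring
    _ = 𝓕 u η * conj (𝓕 g (η - ν)) := by rw [integral_mul_const, ← fourier_eq_integral_osc]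

/-- The squared `L²` norm of the Fourier transform of the window. -/
noncomputable def windowConst (g : 𝓢(Rd d, ℂ)) : ℂ := ∫ ν, conj (𝓕 g ν) * 𝓕 g ν

lemma windowConst_ne_zero {g : 𝓢(Rd d, ℂ)} (hg : g ≠ 0) : windowConst g ≠ 0 := by
  have hgF : 𝓕 g ≠ 0 := by
    intro h
    apply hg
    have h1 : FourierTransform.fourierEquiv ℂ 𝓢(Rd d, ℂ) g = 0 := h
    exact (LinearEquiv.map_eq_zero_iff _).1 h1
  have hsq : ∀ ν, conj (𝓕 g ν) * 𝓕 g ν = ((‖𝓕 g ν‖ ^ 2 : ℝ) : ℂ) := fun ν => by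
    rw [Complex.conj_mul']
    push_cast
    rfl
  intro h0
  simp only [windowConst, hsq] at h0
  rw [integral_complex_ofReal, Complex.ofReal_eq_zero] at h0
  have hcont : Continuous fun ν => ‖𝓕 g ν‖ ^ 2 := ((𝓕 g).continuous.norm).pow 2
  have hint : Integrable fun ν => ‖𝓕 g ν‖ ^ 2 :=
    (memLp_two_iff_integrable_sq_norm (𝓕 g).continuous.aestronglyMeasurable).1
      ((𝓕 g).memLp 2 volume)
  rw [integral_eq_zero_iff_of_nonneg (fun ν => by positivity) hint] at h0
  have h1 := (hcont.ae_eq_iff_eq volume continuous_const).1 h0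
  apply hgF
  ext ν
  have h2 : ‖𝓕 g ν‖ ^ 2 = 0 := congrFun h1 ν
  simpa using h2

end Reconstruction

section ReconstructionJoint

variable {d : ℕ}

lemma aestronglyMeasurable_stft_mul (g u : 𝓢(Rd d, ℂ)) {b : Rd d × Rd d → ℂ}
    (hb : AEStronglyMeasurable b volume) :
    AEStronglyMeasurable (fun p : (Rd d × Rd d) × (Rd d × Rd d) =>
      b p.1 * (stft g (u : 𝓢'(Rd d, ℂ)) p.2 *
        (osc p.2.1 (p.1.2 - p.2.2) * 𝓕 g (p.1.2 - p.2.2)))) (volume.prod volume) := by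
  refine hb.comp_fst.mul (Continuous.aestronglyMeasurable ?_)
  have h1 : Continuous fun p : (Rd d × Rd d) × (Rd d × Rd d) => p.1.2 - p.2.2 := by fun_prop
  have h2 : Continuous fun p : (Rd d × Rd d) × (Rd d × Rd d) => p.2.1 := by fun_prop
  exact ((continuous_stft g u).comp continuous_snd).mul
    ((continuous_osc_comp h2 h1).mul ((𝓕 g).continuous.comp h1))

lemma integrable_stftBound_mul (g u : 𝓢(Rd d, ℂ)) (η : Rd d) :
    Integrable fun w : Rd d × Rd d => stftBound g u w.1 * ‖𝓕 g (η - w.2)‖ :=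
  (integrable_stftBound g u).mul_prod
    (((𝓕 g).integrable (μ := volume)).norm.comp_sub_left η)

lemma norm_stft_mul_le (g u : 𝓢(Rd d, ℂ)) (η : Rd d) (w : Rd d × Rd d) :
    ‖stft g (u : 𝓢'(Rd d, ℂ)) w * (osc w.1 (η - w.2) * 𝓕 g (η - w.2))‖
      ≤ stftBound g u w.1 * ‖𝓕 g (η - w.2)‖ := by
  rw [norm_mul, norm_mul, norm_osc, one_mul]
  gcongr
  exact norm_stft_le g u w

lemma integrable_stft_mul (g u : 𝓢(Rd d, ℂ)) (η : Rd d) :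
    Integrable fun w : Rd d × Rd d =>
      stft g (u : 𝓢'(Rd d, ℂ)) w * (osc w.1 (η - w.2) * 𝓕 g (η - w.2)) := by
  have h1 : Continuous fun w : Rd d × Rd d => η - w.2 := by fun_prop
  exact (integrable_stftBound_mul g u η).mono'
    ((continuous_stft g u).mul ((continuous_osc_comp continuous_fst h1).mul
      ((𝓕 g).continuous.comp h1))).aestronglyMeasurable
    (Filter.Eventually.of_forall (norm_stft_mul_le g u η))

/-- Reconstruction of the Fourier transform from the short-time Fourier transform. -/
theorem integral_stft_mul (g u : 𝓢(Rd d, ℂ)) (η : Rd d) :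
    ∫ w : Rd d × Rd d, stft g (u : 𝓢'(Rd d, ℂ)) w * (osc w.1 (η - w.2) * 𝓕 g (η - w.2))
      = 𝓕 u η * windowConst g := by
  rw [Measure.volume_eq_prod, integral_prod_symm _ (integrable_stft_mul g u η)]
  have h1 : ∀ ν : Rd d, ∫ y, stft g (u : 𝓢'(Rd d, ℂ)) (y, ν) * (osc y (η - ν) * 𝓕 g (η - ν))
      = 𝓕 u η * (conj (𝓕 g (η - ν)) * 𝓕 g (η - ν)) := by
    intro ν
    simp only [← mul_assoc]
    rw [integral_mul_const, integral_stft_mul_osc]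
  simp only [h1]
  rw [integral_const_mul, windowConst]
  congr 1
  exact integral_sub_left_eq_self (fun s => conj (𝓕 g s) * 𝓕 g s) volume η

/-- The reconstruction formula, integrated against a density `b`. Only the integrability of `b`
and of the windows is needed for Fubini's theorem, since `stft g u` is bounded by an integrable
function of the translation alone. -/
theorem integral_mul_fourier_eq (g u : 𝓢(Rd d, ℂ)) {b : Rd d × Rd d → ℂ} (hb : Integrable b) :
    (∫ q, b q * 𝓕 u q.2) * windowConst g = ∫ w : Rd d × Rd d, stft g (u : 𝓢'(Rd d, ℂ)) w *
      ∫ q : Rd d × Rd d, b q * (osc w.1 (q.2 - w.2) * 𝓕 g (q.2 - w.2)) := by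
  set H : ℝ := (∫ y, stftBound g u y) * ∫ ν, ‖𝓕 g ν‖ with hH
  have hHq : ∀ η : Rd d, ∫ w : Rd d × Rd d, stftBound g u w.1 * ‖𝓕 g (η - w.2)‖ = H := by
    intro η
    rw [Measure.volume_eq_prod,
      integral_prod_mul (stftBound g u) (fun ν : Rd d => ‖𝓕 g (η - ν)‖), hH]
    congr 1
    exact integral_sub_left_eq_self (fun s => ‖𝓕 g s‖) volume η
  have hmeas := aestronglyMeasurable_stft_mul g u hb.aestronglyMeasurable
  have hint : Integrable (Function.uncurry fun (q w : Rd d × Rd d) =>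
      b q * (stft g (u : 𝓢'(Rd d, ℂ)) w * (osc w.1 (q.2 - w.2) * 𝓕 g (q.2 - w.2))))
      (volume.prod volume) := by
    refine (integrable_prod_iff hmeas).2 ⟨Filter.Eventually.of_forall fun q =>
      (integrable_stft_mul g u q.2).const_mul (b q), ?_⟩
    refine (hb.norm.mul_const H).mono' hmeas.norm.integral_prod_right'
      (Filter.Eventually.of_forall fun q => ?_)
    simp only [norm_mul (b q), integral_const_mul]
    rw [norm_mul, norm_norm, Real.norm_of_nonneg (integral_nonneg fun _ => norm_nonneg _), ← hHq q.2]
    gcongr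
    · exact (integrable_stft_mul g u q.2).norm
    · exact integrable_stftBound_mul g u q.2
    · exact fun w => norm_stft_mul_le g u q.2 w
  calc (∫ q, b q * 𝓕 u q.2) * windowConst g
      = ∫ q, ∫ w : Rd d × Rd d,
          b q * (stft g (u : 𝓢'(Rd d, ℂ)) w * (osc w.1 (q.2 - w.2) * 𝓕 g (q.2 - w.2))) := by
        simp only [integral_const_mul, integral_stft_mul]
        rw [← integral_mul_const]
        simp only [mul_assoc]
    _ = ∫ w : Rd d × Rd d, ∫ q : Rd d × Rd d,
          b q * (stft g (u : 𝓢'(Rd d, ℂ)) w * (osc w.1 (q.2 - w.2) * 𝓕 g (q.2 - w.2))) :=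
        integral_integral_swap hint
    _ = _ := by
        simp only [← integral_const_mul]
        refine integral_congr_ae (Filter.Eventually.of_forall fun w =>
          integral_congr_ae (Filter.Eventually.of_forall fun q => ?_))
        simp only
        ring

/-- Localization by the translates of a function of integral one. -/
lemma enorm_integral_le_lintegral_localized {F ψ : Rd d × Rd d → ℂ} (hF : Integrable F)
    (hψ : Integrable ψ) (hψ1 : ∫ q, ψ q = 1) :
    ‖∫ q, F q‖ₑ ≤ ∫⁻ c, ‖∫ q, F q * ψ (q - c)‖ₑ := by
  have h1 : ∀ q, ∫ c, F q * ψ (q - c) = F q := fun q => by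
    rw [integral_const_mul, integral_sub_left_eq_self ψ volume q, hψ1, mul_one]
  have hint : Integrable (Function.uncurry fun c q : Rd d × Rd d => F q * ψ (q - c))
      (volume.prod volume) := by
    refine (hF.convolution_integrand (ContinuousLinearMap.mul ℂ ℂ) hψ.comp_neg).congr
      (Filter.Eventually.of_forall fun p => ?_)
    simp [Function.uncurry]
  calc ‖∫ q, F q‖ₑ = ‖∫ q, ∫ c, F q * ψ (q - c)‖ₑ := by simp only [h1]
    _ = ‖∫ c, ∫ q, F q * ψ (q - c)‖ₑ := by
        rw [integral_integral_swap (f := fun c q : Rd d × Rd d => F q * ψ (q - c)) hint]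
    _ ≤ _ := enorm_integral_le_lintegral_enorm _

end ReconstructionJoint

/-! ### The operator in phase space -/

section Operator

variable {d : ℕ}

/-- The oscillating factor, the symbol and the shifted window in the double integral for the
short-time Fourier transform of `A u`. -/
noncomputable def fioWindow (Φ : Rd d × Rd d → ℝ) (σ : Rd d × Rd d → ℂ) (γ : 𝓢(Rd d, ℂ))
    (z q : Rd d × Rd d) : ℂ :=
  Complex.exp (2 * Real.pi * Complex.I * (Φ q : ℝ)) * σ q * (osc z.2 q.1 * γ (q.1 - z.1))

lemma norm_exp_two_pi_I_mul (s : ℝ) : ‖Complex.exp (2 * Real.pi * Complex.I * (s : ℝ))‖ = 1 := by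
  have : 2 * Real.pi * Complex.I * (s : ℝ) = ((2 * Real.pi * s : ℝ) : ℂ) * Complex.I := by
    push_cast; ring
  rw [this, Complex.norm_exp_ofReal_mul_I]

lemma continuous_fioWindow {Φ : Rd d × Rd d → ℝ} {σ : Rd d × Rd d → ℂ} (hΦ : Continuous Φ)
    (hσ : Continuous σ) (γ : 𝓢(Rd d, ℂ)) (z : Rd d × Rd d) :
    Continuous (fioWindow Φ σ γ z) := by
  have h1 : Continuous fun q => Complex.exp (2 * Real.pi * Complex.I * (Φ q : ℝ)) := by fun_prop
  exact (h1.mul hσ).mul ((continuous_osc_comp continuous_const continuous_fst).mul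
    (γ.continuous.comp (continuous_fst.sub continuous_const)))

lemma continuous_fioIntegrand {Φ : Rd d × Rd d → ℝ} {σ : Rd d × Rd d → ℂ} (hΦ : Continuous Φ)
    (hσ : Continuous σ) (u : 𝓢(Rd d, ℂ)) :
    Continuous (Function.uncurry (fioIntegrand Φ σ u)) := by
  have h1 : Continuous fun q => Complex.exp (2 * Real.pi * Complex.I * (Φ q : ℝ)) := by fun_prop
  exact (h1.mul hσ).mul ((𝓕 u).continuous.comp continuous_snd)

lemma norm_fioIntegrand_le {Φ : Rd d × Rd d → ℝ} {σ : Rd d × Rd d → ℂ} {M : ℝ}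
    (hσM : ∀ z, ‖σ z‖ ≤ M) (u : 𝓢(Rd d, ℂ)) (x η : Rd d) :
    ‖fioIntegrand Φ σ u x η‖ ≤ M * ‖𝓕 u η‖ := by
  rw [fioIntegrand, norm_mul, norm_mul, norm_exp_two_pi_I_mul, one_mul]
  gcongr
  exact hσM _

lemma integrable_fioIntegrand {Φ : Rd d × Rd d → ℝ} {σ : Rd d × Rd d → ℂ} (hΦ : Continuous Φ)
    (hσ : Continuous σ) {M : ℝ} (hσM : ∀ z, ‖σ z‖ ≤ M) (u : 𝓢(Rd d, ℂ)) (x : Rd d) :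
    Integrable (fioIntegrand Φ σ u x) := by
  have hc : Continuous (fioIntegrand Φ σ u x) :=
    (continuous_fioIntegrand hΦ hσ u).comp (Continuous.prodMk_right x)
  exact (((𝓕 u).integrable (μ := volume)).norm.const_mul M).mono' hc.aestronglyMeasurable
    (Filter.Eventually.of_forall (norm_fioIntegrand_le hσM u x))

lemma memLp_fio {Φ : Rd d × Rd d → ℝ} {σ : Rd d × Rd d → ℂ} (hΦ : Continuous Φ)
    (hσ : Continuous σ) {M : ℝ} (hσM : ∀ z, ‖σ z‖ ≤ M) (u : 𝓢(Rd d, ℂ)) :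
    MemLp (fio Φ σ u) ⊤ volume := by
  refine memLp_top_of_bound ?_ (∫ η, M * ‖𝓕 u η‖) (Filter.Eventually.of_forall fun x => ?_)
  · exact (continuous_fioIntegrand hΦ hσ u).aestronglyMeasurable.integral_prod_right'
  · exact norm_integral_le_of_norm_le (((𝓕 u).integrable (μ := volume)).norm.const_mul M)
      (Filter.Eventually.of_forall (norm_fioIntegrand_le hσM u x))

lemma integrable_fioWindow_mul {Φ : Rd d × Rd d → ℝ} {σ : Rd d × Rd d → ℂ} (hΦ : Continuous Φ)
    (hσ : Continuous σ) {M : ℝ} (hσM : ∀ z, ‖σ z‖ ≤ M) (γ u : 𝓢(Rd d, ℂ)) (z : Rd d × Rd d) :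
    Integrable fun q : Rd d × Rd d => fioWindow Φ σ γ z q * 𝓕 u q.2 := by
  have h1 : Integrable fun q : Rd d × Rd d => (M * ‖γ (q.1 - z.1)‖) * ‖𝓕 u q.2‖ :=
    ((((γ.integrable (μ := volume)).comp_sub_right z.1).norm).const_mul M).mul_prod
      ((𝓕 u).integrable (μ := volume)).norm
  refine h1.mono' ((continuous_fioWindow hΦ hσ γ z).mul
    ((𝓕 u).continuous.comp continuous_snd)).aestronglyMeasurable
    (Filter.Eventually.of_forall fun q => ?_)
  rw [norm_mul, fioWindow, norm_mul, norm_mul, norm_mul, norm_exp_two_pi_I_mul, norm_osc, one_mul,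
    one_mul]
  gcongr
  exact hσM _

/-- The short-time Fourier transform of `A u` as an absolutely convergent double integral. -/
lemma stft_fio_eq {Φ : Rd d × Rd d → ℝ} {σ : Rd d × Rd d → ℂ} (hΦ : Continuous Φ)
    (hσ : Continuous σ) {M : ℝ} (hσM : ∀ z, ‖σ z‖ ≤ M) (g u : 𝓢(Rd d, ℂ))
    (hA : MemLp (fio Φ σ u) ⊤ volume) (z : Rd d × Rd d) :
    stft g (Lp.toTemperedDistribution (hA.toLp (fio Φ σ u))) z
      = ∫ q, fioWindow Φ σ (conjSchwartz g) z q * 𝓕 u q.2 := by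
  rw [stft, Lp.toTemperedDistribution_apply, Measure.volume_eq_prod,
    integral_prod _ (integrable_fioWindow_mul hΦ hσ hσM (conjSchwartz g) u z)]
  refine integral_congr_ae ?_
  filter_upwards [hA.coeFn_toLp] with t ht
  rw [ht, smul_eq_mul, fio, ← integral_const_mul]
  refine integral_congr_ae (Filter.Eventually.of_forall fun η => ?_)
  simp only [conjTFShift_eq, fioIntegrand, fioWindow]
  ring

/-- The short-time Fourier transform of `A u` is controlled by the one of `u` through the two
kernels. -/
theorem exists_stft_fio_bound (g : 𝓢(Rd d, ℂ)) (hg : g ≠ 0) {ε M : ℝ} (hε : 0 < ε) (hM : 1 ≤ M) :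
    ∃ C : ℝ≥0, ∀ (σ : Rd d × Rd d → ℂ) (Φ : Rd d × Rd d → ℝ), ContDiff ℝ ∞ σ →
      ContDiff ℝ ∞ Φ → (∀ z, ∀ k ≤ 2 * (d + 1), ‖iteratedFDeriv ℝ k σ z‖ ≤ M) →
      (∀ z ∈ euclNhd ε (tsupport σ), ∀ k, 2 ≤ k → k ≤ 2 * (d + 1) →
        ‖iteratedFDeriv ℝ k Φ z‖ ≤ M) →
      ∀ (u : 𝓢(Rd d, ℂ)) (hA : MemLp (fio Φ σ u) ⊤ volume) (z : Rd d × Rd d),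
        ‖stft g (Lp.toTemperedDistribution (hA.toLp (fio Φ σ u))) z‖ₑ
          ≤ C * ∫⁻ c, outKernel Φ z c *
              ∫⁻ w, inKernel Φ c w * ‖stft g (u : 𝓢'(Rd d, ℂ)) w‖ₑ := by
  let bump : ContDiffBump (0 : Rd d × Rd d) := ⟨ε / 8, ε / 4, by positivity, by linarith⟩
  set ψ : Rd d × Rd d → ℂ := fun q => (bump.normed volume q : ℂ) with hψdef
  have hψ : ContDiff ℝ ∞ ψ := Complex.ofRealCLM.contDiff.comp bump.contDiff_normed
  have hψr : tsupport ψ ⊆ Metric.closedBall 0 (ε / 4) := by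
    rw [← bump.tsupport_normed_eq (μ := volume)]
    refine closure_mono fun q hq => ?_
    rw [Function.mem_support] at hq ⊢
    contrapose! hq
    simp only [hψdef, hq, Complex.ofReal_zero]
  have hψc : HasCompactSupport ψ :=
    (isCompact_closedBall _ _).of_isClosed_subset (isClosed_tsupport ψ) hψr
  have hψi : Integrable ψ := hψ.continuous.integrable_of_hasCompactSupport hψc
  have hψ1 : ∫ q, ψ q = 1 := by
    rw [hψdef, integral_complex_ofReal, bump.integral_normed, Complex.ofReal_one]
  obtain ⟨C, hC⟩ := exists_localized_coefficient_bound hε hM hψ hψr (conjSchwartz g) (𝓕 g)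
  set κ := windowConst g with hκ
  have hκ0 : κ ≠ 0 := windowConst_ne_zero hg
  refine ⟨‖κ⁻¹‖₊ * C, fun σ Φ hσ hΦ hσb hΦb u hA z => ?_⟩
  have hσM : ∀ z, ‖σ z‖ ≤ M := fun z => by simpa using hσb z 0 (Nat.zero_le _)
  rw [stft_fio_eq hΦ.continuous hσ.continuous hσM]
  refine (enorm_integral_le_lintegral_localized
    (integrable_fioWindow_mul hΦ.continuous hσ.continuous hσM (conjSchwartz g) u z)
    hψi hψ1).trans ?_
  rw [← lintegral_const_mul' _ _ ENNReal.coe_ne_top]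
  refine lintegral_mono fun c => ?_
  set b : Rd d × Rd d → ℂ := fun q => fioWindow Φ σ (conjSchwartz g) z q * ψ (q - c) with hb
  have hbc : Continuous b := (continuous_fioWindow hΦ.continuous hσ.continuous _ z).mul
    (hψ.continuous.comp (continuous_id.sub continuous_const))
  have hbi : Integrable b := by
    refine hbc.integrable_of_hasCompactSupport (HasCompactSupport.mul_left ?_)
    exact hψc.comp_homeomorph (Homeomorph.subRight c)
  have hrec := integral_mul_fourier_eq g u hbi
  have h1 : ∫ q, fioWindow Φ σ (conjSchwartz g) z q * 𝓕 u q.2 * ψ (q - c)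
      = κ⁻¹ * ∫ w : Rd d × Rd d, stft g (u : 𝓢'(Rd d, ℂ)) w *
        ∫ q : Rd d × Rd d, b q * (osc w.1 (q.2 - w.2) * 𝓕 g (q.2 - w.2)) := by
    rw [← hrec, mul_comm _ (windowConst g), inv_mul_cancel_left₀ hκ0]
    refine integral_congr_ae (Filter.Eventually.of_forall fun q => ?_)
    simp only [hb]
    ring
  have h2 : ∀ w : Rd d × Rd d,
      ‖∫ q : Rd d × Rd d, b q * (osc w.1 (q.2 - w.2) * 𝓕 g (q.2 - w.2))‖ₑ
        ≤ C * (outKernel Φ z c * inKernel Φ c w) := by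
    intro w
    refine le_trans (le_of_eq ?_) (hC σ Φ hσ hΦ hσb hΦb z c w)
    congr 1
    refine integral_congr_ae (Filter.Eventually.of_forall fun q => ?_)
    simp only [hb, fioWindow]
    ring
  have htop : (C : ℝ≥0∞) * outKernel Φ z c ≠ ⊤ := ENNReal.mul_ne_top ENNReal.coe_ne_top
    (ENNReal.mul_ne_top (decayWeight_ne_top _) (decayWeight_ne_top _))
  rw [h1, enorm_mul]
  calc ‖κ⁻¹‖ₑ * ‖∫ w : Rd d × Rd d, stft g (u : 𝓢'(Rd d, ℂ)) w *
        ∫ q : Rd d × Rd d, b q * (osc w.1 (q.2 - w.2) * 𝓕 g (q.2 - w.2))‖ₑ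
      ≤ ‖κ⁻¹‖ₑ * ∫⁻ w : Rd d × Rd d, (C * outKernel Φ z c) *
          (inKernel Φ c w * ‖stft g (u : 𝓢'(Rd d, ℂ)) w‖ₑ) := by
        gcongr
        refine (enorm_integral_le_lintegral_enorm _).trans (lintegral_mono fun w => ?_)
        rw [enorm_mul]
        calc _ ≤ ‖stft g (u : 𝓢'(Rd d, ℂ)) w‖ₑ * (C * (outKernel Φ z c * inKernel Φ c w)) := by
              gcongr
              exact h2 w
          _ = _ := by ring
    _ = ↑(‖κ⁻¹‖₊ * C) * (outKernel Φ z c *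
          ∫⁻ w, inKernel Φ c w * ‖stft g (u : 𝓢'(Rd d, ℂ)) w‖ₑ) := by
        rw [lintegral_const_mul' _ _ htop, ENNReal.coe_mul,
          enorm_eq_nnnorm]
        ring

end Operator

theorem proposition3p5 (d : ℕ) :
    ∃ N : ℕ, ∀ g : 𝓢(Rd d, ℂ), g ≠ 0 → ∀ δ ε M : ℝ, 0 < δ → 0 < ε → ∃ C : ℝ≥0,
      ∀ (Cσ CΦ Cmix : (Fin d → ℕ) → (Fin d → ℕ) → ℝ),
        -- `M` is an upper bound for finitely many of the constants
        (∀ α β, multiLen α + multiLen β ≤ N → Cσ α β ≤ M) →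
        (∀ α β, 2 ≤ multiLen α + multiLen β → multiLen α + multiLen β ≤ N → CΦ α β ≤ M) →
        (∀ α β, multiLen α = 1 → multiLen β = 1 → Cmix α β ≤ M) →
      ∀ (σ : Rd d × Rd d → ℂ) (Φ : Rd d × Rd d → ℝ), ContDiff ℝ ∞ σ → ContDiff ℝ ∞ Φ →
        (∀ α β z, ‖partialEtaX α β σ z‖ ≤ Cσ α β) →
        (∀ α β, 2 ≤ multiLen α + multiLen β →
          ∀ z ∈ euclNhd ε (tsupport σ), |partialEtaX α β Φ z| ≤ CΦ α β) →
        (∀ α β, multiLen α = 1 → multiLen β = 1 → ∀ z, |partialEtaX α β Φ z| ≤ Cmix α β) →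
        (∀ z, δ < |(mixedHessian Φ z).det|) →
      ∀ p : ℝ≥0∞, 1 ≤ p → ∀ u : 𝓢(Rd d, ℂ),
        (∀ x, Integrable (fioIntegrand Φ σ u x)) ∧
        ∃ hA : MemLp (fio Φ σ u) ∞ volume,
          modNorm g p (Lp.toTemperedDistribution (hA.toLp (fio Φ σ u)))
            ≤ C * modNorm g p (u : 𝓢'(Rd d, ℂ)) := by
  -- `2 (d + 1)` derivatives give decay of order `d + 1` in each variable, which is integrable
  refine ⟨2 * (d + 1), fun g hg δ ε M hδ hε => ?_⟩
  set K : ℝ := (2 * d + 1) ^ (2 * (d + 1)) * max M 1 with hK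
  have hbase : (1 : ℝ) ≤ 2 * d + 1 := by linarith [(Nat.cast_nonneg d : (0 : ℝ) ≤ d)]
  have hM1 : (1 : ℝ) ≤ max M 1 := le_max_right _ _
  have hK1 : 1 ≤ K := one_le_mul_of_one_le_of_one_le (one_le_pow₀ hbase) hM1
  have hpow : ∀ k ≤ 2 * (d + 1), (2 * d : ℝ) ^ k * max M 1 ≤ K := by
    intro k hk
    rw [hK]
    gcongr
    calc (2 * d : ℝ) ^ k ≤ (2 * d + 1) ^ k := by gcongr; linarith
      _ ≤ (2 * d + 1) ^ (2 * (d + 1)) := pow_le_pow_right₀ hbase hk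
  obtain ⟨C, hC⟩ := exists_stft_fio_bound g hg hε hK1
  refine ⟨C * (schurConst d δ ^ 2).toNNReal, ?_⟩
  intro Cσ CΦ Cmix hCσ hCΦ hCmix σ Φ hσ hΦ hσb hΦb hmix hdet p hp u
  have hσK : ∀ z, ∀ k ≤ 2 * (d + 1), ‖iteratedFDeriv ℝ k σ z‖ ≤ K := fun z k hk =>
    (norm_iteratedFDeriv_le_of_partialEtaX hσ (zero_le_one.trans hM1) fun α β hαβ =>
      (hσb α β z).trans ((hCσ α β (hαβ.trans_le hk)).trans (le_max_left _ _))).trans (hpow k hk)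
  have hΦK : ∀ z ∈ euclNhd ε (tsupport σ), ∀ k, 2 ≤ k → k ≤ 2 * (d + 1) →
      ‖iteratedFDeriv ℝ k Φ z‖ ≤ K := fun z hz k hk2 hk =>
    (norm_iteratedFDeriv_le_of_partialEtaX hΦ (zero_le_one.trans hM1) fun α β hαβ =>
      (hΦb α β (hk2.trans_eq hαβ.symm) z hz).trans
        ((hCΦ α β (hk2.trans_eq hαβ.symm) (hαβ.trans_le hk)).trans (le_max_left _ _))).trans
      (hpow k hk)
  have hmixM : ∀ z i l, |mixedHessian Φ z i l| ≤ M := fun z i l => by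
    have h1 : ∀ j : Fin d, multiLen (Pi.single j 1 : Fin d → ℕ) = 1 := fun j => by
      simp [multiLen]
    exact (hmix _ _ (h1 l) (h1 i) z).trans (hCmix _ _ (h1 l) (h1 i))
  have hσM : ∀ z, ‖σ z‖ ≤ K := fun z => by simpa using hσK z 0 (Nat.zero_le _)
  refine ⟨integrable_fioIntegrand hΦ.continuous hσ.continuous hσM u,
    memLp_fio hΦ.continuous hσ.continuous hσM u, ?_⟩
  have hpt := hC σ Φ hσ hΦ hσK hΦK u (memLp_fio hΦ.continuous hσ.continuous hσM u)
  have hmeas : Measurable fun w => ‖stft g (u : 𝓢'(Rd d, ℂ)) w‖ₑ :=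
    (continuous_stft g u).measurable.enorm
  have hschur := eLpNorm_outKernel_inKernel_le hΦ hδ hmixM hdet hmeas hp
  rw [eLpNorm_enorm] at hschur
  have hfirst := eLpNorm_le_nnreal_smul_eLpNorm_of_ae_le_mul' (μ := volume) (c := C)
    (f := stft g (Lp.toTemperedDistribution
      ((memLp_fio hΦ.continuous hσ.continuous hσM u).toLp (fio Φ σ u))))
    (g := fun z => ∫⁻ c, outKernel Φ z c *
      ∫⁻ w, inKernel Φ c w * ‖stft g (u : 𝓢'(Rd d, ℂ)) w‖ₑ)
    (Filter.Eventually.of_forall fun z => by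
      rw [enorm_eq_self]
      exact hpt z) p
  calc _ ≤ C • eLpNorm (fun z => ∫⁻ c, outKernel Φ z c *
              ∫⁻ w, inKernel Φ c w * ‖stft g (u : 𝓢'(Rd d, ℂ)) w‖ₑ) p volume := hfirst
    _ ≤ C * (schurConst d δ ^ 2 * modNorm g p (u : 𝓢'(Rd d, ℂ))) := by
        rw [ENNReal.smul_def, smul_eq_mul]
        gcongr
        exact hschur
    _ = _ := by
        rw [ENNReal.coe_mul, ENNReal.coe_toNNReal (ENNReal.pow_lt_top (schurConst_lt_top d δ)).ne,
          mul_assoc]
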